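/- Let $d\ge 1$, let $\Omega\subset\mathbb R^d$ be a bounded domain (nonempty, open, connected), and let $m_s=(d-2)_+/(d+2)$. Let $\lambda_1\le\lambda_2\le\dots$ be the eigenvalues of the Dirichlet Laplacian $-\Delta$ on $\Omega$, counted with multiplicity, and put $\Lambda=\lambda_2-\lambda_1$. Let $\Phi_1\in W_0^{1,2}(\Omega)$ be the eigenfunction for $\lambda_1$ with $\Phi_1>0$ in $\Omega$ and $\|\Phi_1\|_{L^2(\Omega)}=1$; assume that it is continuous on $\overline\Omega$ and vanishes on $\partial\Omega$ (as is the case if $\partial\Omega$ is of class $C^{2,\alpha}$). For a weight $w\ge 0$ on $\Omega$ with $0<\int_\Omega w\,dx<\infty$ and a function $g$ write $\overline g^{\,w}=\int_\Omega g\,w\,dx\big/\int_\Omega w\,dx$. For $m\in(m_s,1]$ let constants $k_0(m)>0$ and $k_1(m)$ be given with $\lim_{m\uparrow1}k_0(m)=\lim_{m\uparrow1}k_1(m)=1$, and say that a measurable weight $S\ge0$ satisfies $(\mathrm H_m)$ if $$k_0(m)\,\Phi_1(x)\le S(x)^m\le k_1(m)\,\Phi_1(x)\qquad\text{for all }x\in\overline\Omega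 .$$ **(0)** $\Lambda>0$, and $\Lambda$ is the largest constant $C$ such that $C\int_\Omega|g-\overline g^{\,\Phi_1^2}|^2\Phi_1^2\,dx\le\int_\Omega|\nabla g|^2\Phi_1^2\,dx$ for all $g=f/\Phi_1$ with $f\in W_0^{1,2}(\Omega)$. **(1)** Let $m_s<m\le1$ and let $S_m$ be a weight satisfying $(\mathrm H_m)$. Then for every $f\in W^{1,2}_0(\Omega)$ and $g=f/\Phi_1$, $$\frac{\Lambda\,k_0(m)^2}{k_1(m)^2\,\|S_m\|_\infty^{1-m}}\int_\Omega|g-\overline g|^2\,S_m^{1+m}\,dx\;\le\;\int_\Omega|\nabla g|^2\,S_m^{2m}\,dx,\qquad \overline g=\overline g^{\,S_m^{1+m}} .$$ **(2)** Let $m_s<m<1$, ${\bf c}>0$, and let $S_{c,m}$ be a solution of $-\Delta(S^m)={\bf c}\,S$ in $\Omega$, $S>0$ in $\Omega$, $S=0$ on $\partial\Omega$ (that is, $S$ is continuous on $\overline\Omega$, $S^m\in W_0^{1,2}(\Omega)$, and the equation holds weakly against $W_0^{1,2}(\Omega)$). Suppose that the normalized profile $S_m=S_{c,m}/\|S_{c,m}\|_{L^{m+1}(\Omega)}$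 satisfies $(\mathrm H_m)$. Then for every $f\in W_0^{1,2}(\Omega)$ and $g=f/\Phi_1$, $$\frac{\Lambda\,k_0(m)^2}{k_1(m)^2\,\|S_{c,m}\|_\infty^{1-m}}\int_\Omega|g-\overline g|^2\,S_{c,m}^{1+m}\,dx\;\le\;\int_\Omega|\nabla g|^2\,S_{c,m}^{2m}\,dx,\qquad \overline g=\overline g^{\,S_{c,m}^{1+m}} .$$ **(3)** $\lim_{m\uparrow1}k_1(m)/k_0(m)=1$. In (0), (1) and (2), $\nabla g$ is the weak gradient of $g$ in $\Omega$; it is part of the claim that it exists, that the weight defining the mean is integrable with positive integral, that the mean is well defined, and that both integrals converge (in (0), for every such $g$). -/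

import Mathlib

open MeasureTheory Set Filter Topology
open scoped ContDiff ENNReal

noncomputable section

namespace FastDiffusion

/-- Smooth functions with compact support contained in `Ω`. -/
def IsTestFunction {d : ℕ} (Ω : Set (EuclideanSpace ℝ (Fin d)))
    (φ : EuclideanSpace ℝ (Fin d) → ℝ) : Prop :=
  ContDiff ℝ ∞ φ ∧ HasCompactSupport φ ∧ tsupport φ ⊆ Ω

/-- `f` belongs to `W_0^{1,2}(Ω)` and `F` is its gradient: the pair `(f, F)` lies in the closure of
`{(φ, ∇φ) : φ a test function}` in `L²(Ω) × L²(Ω; ℝ^d)`. Only the values on `Ω` matter. -/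
def MemW012 {d : ℕ} (Ω : Set (EuclideanSpace ℝ (Fin d)))
    (f : EuclideanSpace ℝ (Fin d) → ℝ)
    (F : EuclideanSpace ℝ (Fin d) → EuclideanSpace ℝ (Fin d)) : Prop :=
  MemLp f 2 (volume.restrict Ω) ∧ MemLp F 2 (volume.restrict Ω) ∧
    ∃ φ : ℕ → EuclideanSpace ℝ (Fin d) → ℝ,
      (∀ n, IsTestFunction Ω (φ n)) ∧
      Tendsto (fun n => eLpNorm (fun x => φ n x - f x) 2 (volume.restrict Ω)) atTop (𝓝 0) ∧
      Tendsto (fun n => eLpNorm (fun x => gradient (φ n) x - F x) 2 (volume.restrict Ω))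
        atTop (𝓝 0)

/-- `G` is the distributional gradient on `Ω` of the locally integrable function `g`. -/
def HasWeakGradient {d : ℕ} (Ω : Set (EuclideanSpace ℝ (Fin d)))
    (g : EuclideanSpace ℝ (Fin d) → ℝ)
    (G : EuclideanSpace ℝ (Fin d) → EuclideanSpace ℝ (Fin d)) : Prop :=
  LocallyIntegrableOn g Ω volume ∧ LocallyIntegrableOn G Ω volume ∧
    ∀ φ : EuclideanSpace ℝ (Fin d) → ℝ, IsTestFunction Ω φ →
      ∀ v : EuclideanSpace ℝ (Fin d),
        ∫ x in Ω, g x * inner ℝ (gradient φ x) v = -∫ x in Ω, φ x * inner ℝ (G x) v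

/-- `u ≠ 0` is an eigenfunction, with eigenvalue `μ`, of the Dirichlet Laplacian `-Δ` on `Ω`
(the self-adjoint operator of the closure of the form `∫ |∇u|²` on test functions). -/
def IsDirichletEigenfunction {d : ℕ} (Ω : Set (EuclideanSpace ℝ (Fin d))) (μ : ℝ)
    (u : EuclideanSpace ℝ (Fin d) → ℝ) : Prop :=
  (¬ u =ᵐ[volume.restrict Ω] 0) ∧
    ∃ U : EuclideanSpace ℝ (Fin d) → EuclideanSpace ℝ (Fin d), MemW012 Ω u U ∧
      ∀ v V, MemW012 Ω v V → ∫ x in Ω, inner ℝ (U x) (V x) = μ * ∫ x in Ω, u x * v x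

/-- The `k`-th eigenvalue (`k = 1, 2, …`) of the Dirichlet Laplacian on `Ω`, in nondecreasing order
and counted with multiplicity: the least `t` such that there are `k` eigenfunctions, orthonormal in
`L²(Ω)`, whose eigenvalues are at most `t`. -/
def dirichletEigenvalue {d : ℕ} (Ω : Set (EuclideanSpace ℝ (Fin d))) (k : ℕ) : ℝ :=
  sInf {t : ℝ | ∃ (μ : Fin k → ℝ) (u : Fin k → EuclideanSpace ℝ (Fin d) → ℝ),
    (∀ i, IsDirichletEigenfunction Ω (μ i) (u i)) ∧
    (∀ i j, ∫ x in Ω, u i x * u j x = if i = j then 1 else 0) ∧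
    ∀ i, μ i ≤ t}

/-- `Φ` is the ground state `Φ₁` of the Dirichlet Laplacian on `Ω`: the eigenfunction for the first
eigenvalue that is positive in `Ω`, normalized by `‖Φ₁‖₂ = 1`, in its representative that is
continuous up to the boundary. -/
structure IsGroundState {d : ℕ} (Ω : Set (EuclideanSpace ℝ (Fin d)))
    (Φ : EuclideanSpace ℝ (Fin d) → ℝ) : Prop where
  continuousOn : ContinuousOn Φ (closure Ω)
  pos : ∀ x ∈ Ω, 0 < Φ x
  eq_zero : ∀ x ∈ frontier Ω, Φ x = 0
  eigenfunction : IsDirichletEigenfunction Ω (dirichletEigenvalue Ω 1) Φ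
  norm_eq_one : ∫ x in Ω, Φ x ^ 2 = 1

/-- The exponent `m_s = (d - 2)₊ / (d + 2)`. -/
def sobolevExponent (d : ℕ) : ℝ := max ((d : ℝ) - 2) 0 / ((d : ℝ) + 2)

/-- The two-sided bound `k₀ Φ₁ ≤ S^m ≤ k₁ Φ₁` on the closure of `Ω`, for a weight `S ≥ 0`. -/
structure IsComparableWeight {d : ℕ} (Ω : Set (EuclideanSpace ℝ (Fin d)))
    (Φ : EuclideanSpace ℝ (Fin d) → ℝ) (m k₀ k₁ : ℝ) (S : EuclideanSpace ℝ (Fin d) → ℝ) :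
    Prop where
  aestronglyMeasurable : AEStronglyMeasurable S (volume.restrict Ω)
  nonneg : ∀ x ∈ closure Ω, 0 ≤ S x
  lower : ∀ x ∈ closure Ω, k₀ * Φ x ≤ S x ^ m
  upper : ∀ x ∈ closure Ω, S x ^ m ≤ k₁ * Φ x

/-- `S` is a positive solution of `-Δ(S^m) = c S` in `Ω`, `S = 0` on `∂Ω`: `S` is continuous up to
the boundary, `S^m ∈ W_0^{1,2}(Ω)`, and the equation holds when tested with `W_0^{1,2}(Ω)`. -/
structure IsStationaryProfile {d : ℕ} (Ω : Set (EuclideanSpace ℝ (Fin d))) (m c : ℝ)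
    (S : EuclideanSpace ℝ (Fin d) → ℝ) : Prop where
  continuousOn : ContinuousOn S (closure Ω)
  pos : ∀ x ∈ Ω, 0 < S x
  eq_zero : ∀ x ∈ frontier Ω, S x = 0
  weak_solution : ∃ U : EuclideanSpace ℝ (Fin d) → EuclideanSpace ℝ (Fin d),
    MemW012 Ω (fun x => S x ^ m) U ∧
      ∀ v V, MemW012 Ω v V → ∫ x in Ω, inner ℝ (U x) (V x) = c * ∫ x in Ω, S x * v x

/-- The rescaled profile `S_m = S / ‖S‖_{m+1}`, for which `‖S_m‖_{m+1} = 1`. If `S` solves the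
stationary problem with constant `c`, then `S_m` solves it with `λ_m = c ‖S‖_{m+1}^{1-m}`, and
`S = (λ_m / c)^{1/(1-m)} S_m`. -/
def normalizedProfile {d : ℕ} (Ω : Set (EuclideanSpace ℝ (Fin d))) (m : ℝ)
    (S : EuclideanSpace ℝ (Fin d) → ℝ) : EuclideanSpace ℝ (Fin d) → ℝ :=
  fun x => S x / (∫ y in Ω, S y ^ (m + 1)) ^ (1 / (m + 1))

/-- The norm of `S` in `L^∞(Ω)`. -/
def supNorm {d : ℕ} (Ω : Set (EuclideanSpace ℝ (Fin d)))
    (S : EuclideanSpace ℝ (Fin d) → ℝ) : ℝ :=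
  (eLpNorm S ∞ (volume.restrict Ω)).toReal

/-- The mean of `g` over `Ω` with respect to the measure `w dx`. -/
def weightedMean {d : ℕ} (Ω : Set (EuclideanSpace ℝ (Fin d)))
    (w g : EuclideanSpace ℝ (Fin d) → ℝ) : ℝ :=
  (∫ x in Ω, g x * w x) / ∫ x in Ω, w x

/-- `C ∫_Ω |g - ḡ|² w dx ≤ ∫_Ω |∇g|² W dx`, where `ḡ` is the mean of `g` with respect to `w dx`,
together with the facts that give every term a meaning: `g` has a weak gradient `G` in `Ω`
(unique up to null sets), `ḡ` is well defined, and both integrals converge. -/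
def WeightedPoincare {d : ℕ} (Ω : Set (EuclideanSpace ℝ (Fin d))) (C : ℝ)
    (w W g : EuclideanSpace ℝ (Fin d) → ℝ) : Prop :=
  ∃ G : EuclideanSpace ℝ (Fin d) → EuclideanSpace ℝ (Fin d), HasWeakGradient Ω g G ∧
    IntegrableOn w Ω ∧ 0 < ∫ x in Ω, w x ∧
    IntegrableOn (fun x => g x * w x) Ω ∧
    IntegrableOn (fun x => |g x - weightedMean Ω w g| ^ 2 * w x) Ω ∧
    IntegrableOn (fun x => ‖G x‖ ^ 2 * W x) Ω ∧
    C * ∫ x in Ω, |g x - weightedMean Ω w g| ^ 2 * w x ≤ ∫ x in Ω, ‖G x‖ ^ 2 * W x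

end FastDiffusion

end

noncomputable section

namespace FastDiffusion

/-! ### Calculus of test functions. -/

section TestFunctions

variable {d : ℕ} {Ω : Set (EuclideanSpace ℝ (Fin d))} {φ ψ : EuclideanSpace ℝ (Fin d) → ℝ}

/-! Write $f=g\Phi$ with $\Phi$ the ground state and $U=\nabla\Phi$. Then $\Phi\nabla g=\nabla
f-(f/\Phi)U$, and testing the eigenvalue equation with $f^2/\Phi$ gives the ground state
representation $\int|\nabla g|^2\Phi^2=\int|\nabla f|^2-\lambda_1\int f^2$ (`MemW012.sub_div_smul`).
It is computed for test functions, where $f^2/\Phi$ is admissible because $\Phi$ is bounded below on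
compact subsets of $\Omega$. It extends to all of $W_0^{1,2}$ by completeness of $L^2$, so no
boundary regularity or Hardy inequality enters.

The left side does not change when a multiple of $\Phi$ is subtracted from $f$. Choosing that
multiple so that the remainder is orthogonal to $\Phi$, the variational characterization of
$\lambda_2$ on $\Phi^\perp$ gives the inequality with weight $\Phi^2$ and constant $\Lambda$
(`IsGroundState.spectral_gap_le`). The quotient of a second eigenfunction by $\Phi$ shows that
$\Lambda$ is optimal.

Since eigenvalues are defined through orthonormal eigenfunctions, that characterization has to be
proved (`IsGroundState.exists_second_eigenfunction`). Rellich compactness yields a minimizer of the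
Rayleigh quotient on $\Phi^\perp$, which is an eigenfunction, and any plane spanned by two
eigenfunctions meets $\Phi^\perp$. If the minimum were $\lambda_1$, the representation would give
$\nabla(f/\Phi)=0$ for the minimizer $f$. By connectedness $f$ would be a multiple of $\Phi$,
contradicting orthogonality.

Other weights follow by comparison: $S^{1+m}=S^{1-m}(S^m)^2\le\|S\|_\infty^{1-m}k_1^2\Phi^2$ and
$S^{2m}\ge k_0^2\Phi^2$, while the weighted mean minimizes $c\mapsto\int|g-c|^2w$. Part (2) reduces
to part (1) by homogeneity under $S\mapsto NS$. -/

theorem gradient_add_apply {x : EuclideanSpace ℝ (Fin d)} (hφ : DifferentiableAt ℝ φ x)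
    (hψ : DifferentiableAt ℝ ψ x) :
    gradient (fun y => φ y + ψ y) x = gradient φ x + gradient ψ x := by
  refine ext_inner_right ℝ fun v => ?_
  rw [inner_add_left, inner_gradient_left, inner_gradient_left, inner_gradient_left,
    fderiv_fun_add hφ hψ]
  rfl

theorem gradient_const_mul_apply {x : EuclideanSpace ℝ (Fin d)} (a : ℝ)
    (hφ : DifferentiableAt ℝ φ x) :
    gradient (fun y => a * φ y) x = a • gradient φ x := by
  refine ext_inner_right ℝ fun v => ?_
  rw [real_inner_smul_left, inner_gradient_left, inner_gradient_left, fderiv_const_mul hφ]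
  rfl

theorem gradient_mul_comp_apply {x : EuclideanSpace ℝ (Fin d)} {θ : ℝ → ℝ}
    (hφ : DifferentiableAt ℝ φ x) (hψ : DifferentiableAt ℝ ψ x)
    (hθ : DifferentiableAt ℝ θ (ψ x)) :
    gradient (fun y => φ y * θ (ψ y)) x =
      θ (ψ x) • gradient φ x + (φ x * deriv θ (ψ x)) • gradient ψ x := by
  refine ext_inner_right ℝ fun v => ?_
  have h1 : HasFDerivAt (fun y => θ (ψ y)) (deriv θ (ψ x) • fderiv ℝ ψ x) x :=
    hθ.hasDerivAt.comp_hasFDerivAt x hψ.hasFDerivAt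
  have h2 := hφ.hasFDerivAt.mul h1
  rw [inner_add_left, real_inner_smul_left, real_inner_smul_left, inner_gradient_left,
    inner_gradient_left, inner_gradient_left]
  have : fderiv ℝ (fun y => φ y * θ (ψ y)) x = _ := h2.fderiv
  rw [this]
  simp
  ring

namespace IsTestFunction

theorem differentiable (h : IsTestFunction Ω φ) : Differentiable ℝ φ :=
  h.1.differentiable (by simp)

theorem continuous (h : IsTestFunction Ω φ) : Continuous φ := h.1.continuous

theorem continuous_gradient (h : IsTestFunction Ω φ) : Continuous (gradient φ) :=
  (InnerProductSpace.toDual ℝ (EuclideanSpace ℝ (Fin d))).symm.continuous.comp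
    (h.1.continuous_fderiv (by simp))

theorem tsupport_gradient_subset : tsupport (gradient φ) ⊆ tsupport φ := by
  refine closure_minimal (fun x hx => ?_) (isClosed_tsupport φ)
  by_contra hx'
  apply hx
  have : fderiv ℝ φ x = 0 := by
    by_contra h
    exact hx' (support_fderiv_subset ℝ h)
  simp [gradient, this]

theorem hasCompactSupport_gradient (h : IsTestFunction Ω φ) : HasCompactSupport (gradient φ) :=
  h.2.1.of_isClosed_subset (isClosed_tsupport _) tsupport_gradient_subset

theorem memLp (h : IsTestFunction Ω φ) (p : ℝ≥0∞) : MemLp φ p (volume.restrict Ω) :=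
  (h.continuous.memLp_of_hasCompactSupport h.2.1).restrict Ω

theorem memLp_gradient (h : IsTestFunction Ω φ) (p : ℝ≥0∞) :
    MemLp (gradient φ) p (volume.restrict Ω) :=
  (h.continuous_gradient.memLp_of_hasCompactSupport h.hasCompactSupport_gradient).restrict Ω

theorem zero : IsTestFunction Ω (fun _ => 0) :=
  ⟨contDiff_const, HasCompactSupport.zero, by simp [tsupport]⟩

theorem add (h : IsTestFunction Ω φ) (h' : IsTestFunction Ω ψ) :
    IsTestFunction Ω (fun x => φ x + ψ x) :=
  ⟨h.1.add h'.1, h.2.1.add h'.2.1,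
    (tsupport_add φ ψ).trans (union_subset h.2.2 h'.2.2)⟩

theorem mul_left {χ : EuclideanSpace ℝ (Fin d) → ℝ} (h : IsTestFunction Ω φ)
    (hχ : ContDiff ℝ ∞ χ) : IsTestFunction Ω (fun x => φ x * χ x) :=
  ⟨h.1.mul hχ, h.2.1.mul_right, (tsupport_mul_subset_left).trans h.2.2⟩

theorem const_mul (h : IsTestFunction Ω φ) (a : ℝ) : IsTestFunction Ω (fun x => a * φ x) := by
  simpa [mul_comm] using h.mul_left (contDiff_const (c := a))

theorem sub (h : IsTestFunction Ω φ) (h' : IsTestFunction Ω ψ) :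
    IsTestFunction Ω (fun x => φ x - ψ x) := by
  simpa [sub_eq_add_neg] using h.add (h'.const_mul (-1))

theorem gradient_sub (h : IsTestFunction Ω φ) (h' : IsTestFunction Ω ψ)
    (x : EuclideanSpace ℝ (Fin d)) :
    gradient (fun y => φ y - ψ y) x = gradient φ x - gradient ψ x := by
  have e : (fun y => φ y - ψ y) = fun y => φ y + (-1) * ψ y := by ext; ring
  rw [e, gradient_add_apply (h.differentiable x) ((h'.const_mul (-1)).differentiable x),
    gradient_const_mul_apply _ (h'.differentiable x)]
  simp [sub_eq_add_neg]

end IsTestFunction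

end TestFunctions

/-! ### The space $W_0^{1,2}(\Omega)$ as a closed subspace of $L^2\times L^2$. -/

section EnergySpace

variable {d : ℕ} (Ω : Set (EuclideanSpace ℝ (Fin d)))

/-- The pairs `(φ, ∇φ)`, `φ` a test function, as elements of `L²(Ω) × L²(Ω; ℝ^d)`. -/
def testPairs : Submodule ℝ (Lp ℝ 2 (volume.restrict Ω) ×
    Lp (EuclideanSpace ℝ (Fin d)) 2 (volume.restrict Ω)) where
  carrier := {p | ∃ φ, IsTestFunction Ω φ ∧ p.1 =ᵐ[volume.restrict Ω] φ ∧
    p.2 =ᵐ[volume.restrict Ω] gradient φ}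
  add_mem' := by
    rintro ⟨a, A⟩ ⟨b, B⟩ ⟨φ, hφ, h1, h2⟩ ⟨ψ, hψ, h3, h4⟩
    refine ⟨_, hφ.add hψ, ?_, ?_⟩
    · filter_upwards [h1, h3, Lp.coeFn_add a b] with x hx hx' hx''
      simp only [Prod.fst_add, hx'', Pi.add_apply]
      rw [hx, hx']
    · filter_upwards [h2, h4, Lp.coeFn_add A B] with x hx hx' hx''
      simp only [Prod.snd_add, hx'', Pi.add_apply]
      rw [gradient_add_apply (hφ.differentiable x) (hψ.differentiable x), hx, hx']
  zero_mem' := by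
    refine ⟨_, IsTestFunction.zero, ?_, ?_⟩
    · exact Lp.coeFn_zero _ _ _
    · filter_upwards [Lp.coeFn_zero (EuclideanSpace ℝ (Fin d)) 2 (volume.restrict Ω)] with x hx
      simp only [Prod.snd_zero, hx]
      simp [gradient]
  smul_mem' := by
    rintro c ⟨a, A⟩ ⟨φ, hφ, h1, h2⟩
    refine ⟨_, hφ.const_mul c, ?_, ?_⟩
    · filter_upwards [h1, Lp.coeFn_smul c a] with x hx hx''
      simp only [Prod.smul_fst, hx'', Pi.smul_apply]
      rw [hx, smul_eq_mul]
    · filter_upwards [h2, Lp.coeFn_smul c A] with x hx hx''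
      simp only [Prod.smul_snd, hx'', Pi.smul_apply]
      rw [gradient_const_mul_apply _ (hφ.differentiable x), hx]

/-- `W_0^{1,2}(Ω)` as the closed subspace of the pairs `(f, ∇f)` in `L²(Ω) × L²(Ω; ℝ^d)`. -/
def energySpace : Submodule ℝ (Lp ℝ 2 (volume.restrict Ω) ×
    Lp (EuclideanSpace ℝ (Fin d)) 2 (volume.restrict Ω)) :=
  (testPairs Ω).topologicalClosure

variable {Ω}

theorem tendsto_toLp_iff {ι F : Type*} [NormedAddCommGroup F] {l : Filter ι}
    {μ : Measure (EuclideanSpace ℝ (Fin d))} {u : ι → EuclideanSpace ℝ (Fin d) → F}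
    {f : EuclideanSpace ℝ (Fin d) → F} (hu : ∀ n, MemLp (u n) 2 μ) (hf : MemLp f 2 μ) :
    Tendsto (fun n => (hu n).toLp (u n)) l (𝓝 (hf.toLp f)) ↔
      Tendsto (fun n => eLpNorm (fun x => u n x - f x) 2 μ) l (𝓝 0) := by
  rw [Lp.tendsto_Lp_iff_tendsto_eLpNorm'']
  rfl

/-- In a metric space closure points are limits of sequences. This makes linearity and closedness
available for `MemW012`. -/
theorem memW012_iff {f : EuclideanSpace ℝ (Fin d) → ℝ}
    {F : EuclideanSpace ℝ (Fin d) → EuclideanSpace ℝ (Fin d)} :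
    MemW012 Ω f F ↔ ∃ (hf : MemLp f 2 (volume.restrict Ω)) (hF : MemLp F 2 (volume.restrict Ω)),
      (hf.toLp f, hF.toLp F) ∈ energySpace Ω := by
  constructor
  · rintro ⟨hf, hF, φ, hφ, h1, h2⟩
    refine ⟨hf, hF, ?_⟩
    refine mem_closure_of_tendsto
      (f := fun n => (((hφ n).memLp 2).toLp (φ n), ((hφ n).memLp_gradient 2).toLp (gradient (φ n))))
      (b := atTop) ?_ ?_
    · exact ((tendsto_toLp_iff _ _).2 h1).prodMk_nhds ((tendsto_toLp_iff _ _).2 h2)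
    · exact Eventually.of_forall fun n =>
        ⟨φ n, hφ n, ((hφ n).memLp 2).coeFn_toLp, ((hφ n).memLp_gradient 2).coeFn_toLp⟩
  · rintro ⟨hf, hF, h⟩
    refine ⟨hf, hF, ?_⟩
    obtain ⟨p, hp, hlim⟩ := mem_closure_iff_seq_limit.1 h
    choose φ hφ h1 h2 using hp
    have e : p = fun n => (((hφ n).memLp 2).toLp (φ n),
        ((hφ n).memLp_gradient 2).toLp (gradient (φ n))) := by
      ext1 n
      refine Prod.ext ?_ ?_
      · exact Lp.ext ((h1 n).trans ((hφ n).memLp 2).coeFn_toLp.symm)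
      · exact Lp.ext ((h2 n).trans ((hφ n).memLp_gradient 2).coeFn_toLp.symm)
    rw [e] at hlim
    exact ⟨φ, hφ, (tendsto_toLp_iff (fun n => (hφ n).memLp 2) hf).1
        (continuous_fst.continuousAt.tendsto.comp hlim),
      (tendsto_toLp_iff (fun n => (hφ n).memLp_gradient 2) hF).1
        (continuous_snd.continuousAt.tendsto.comp hlim)⟩

theorem memW012_coeFn_iff {p : Lp ℝ 2 (volume.restrict Ω) ×
    Lp (EuclideanSpace ℝ (Fin d)) 2 (volume.restrict Ω)} :
    MemW012 Ω p.1 p.2 ↔ p ∈ energySpace Ω := by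
  rw [memW012_iff]
  simp only [Lp.toLp_coeFn, exists_prop, Prod.mk.eta]
  exact ⟨fun h => h.2.2, fun h => ⟨Lp.memLp _, Lp.memLp _, h⟩⟩

theorem isClosed_energySpace : IsClosed (energySpace Ω : Set (Lp ℝ 2 (volume.restrict Ω) ×
    Lp (EuclideanSpace ℝ (Fin d)) 2 (volume.restrict Ω))) :=
  Submodule.isClosed_topologicalClosure _

namespace MemW012

variable {f g : EuclideanSpace ℝ (Fin d) → ℝ}
    {F G : EuclideanSpace ℝ (Fin d) → EuclideanSpace ℝ (Fin d)}

theorem congr (h : MemW012 Ω f F) (hf : f =ᵐ[volume.restrict Ω] g)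
    (hF : F =ᵐ[volume.restrict Ω] G) : MemW012 Ω g G := by
  obtain ⟨h1, h2, h3⟩ := memW012_iff.1 h
  refine memW012_iff.2 ⟨h1.ae_eq hf, h2.ae_eq hF, ?_⟩
  rwa [← MemLp.toLp_congr h1 (h1.ae_eq hf) hf, ← MemLp.toLp_congr h2 (h2.ae_eq hF) hF]

theorem add (h : MemW012 Ω f F) (h' : MemW012 Ω g G) : MemW012 Ω (f + g) (F + G) := by
  obtain ⟨h1, h2, h3⟩ := memW012_iff.1 h
  obtain ⟨h1', h2', h3'⟩ := memW012_iff.1 h'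
  exact memW012_iff.2 ⟨h1.add h1', h2.add h2', (energySpace Ω).add_mem h3 h3'⟩

theorem smul (h : MemW012 Ω f F) (a : ℝ) : MemW012 Ω (a • f) (a • F) := by
  obtain ⟨h1, h2, h3⟩ := memW012_iff.1 h
  exact memW012_iff.2 ⟨h1.const_smul a, h2.const_smul a, (energySpace Ω).smul_mem a h3⟩

theorem of_tendsto {u : ℕ → EuclideanSpace ℝ (Fin d) → ℝ}
    {U : ℕ → EuclideanSpace ℝ (Fin d) → EuclideanSpace ℝ (Fin d)}
    (hu : ∀ n, MemW012 Ω (u n) (U n)) (hf : MemLp f 2 (volume.restrict Ω))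
    (hF : MemLp F 2 (volume.restrict Ω))
    (h : Tendsto (fun n => eLpNorm (fun x => u n x - f x) 2 (volume.restrict Ω)) atTop (𝓝 0))
    (h' : Tendsto (fun n => eLpNorm (fun x => U n x - F x) 2 (volume.restrict Ω)) atTop (𝓝 0)) :
    MemW012 Ω f F := by
  choose h1 h2 h3 using fun n => memW012_iff.1 (hu n)
  refine memW012_iff.2 ⟨hf, hF, isClosed_energySpace.mem_of_tendsto
    (((tendsto_toLp_iff h1 hf).2 h).prodMk_nhds ((tendsto_toLp_iff h2 hF).2 h'))
    (Eventually.of_forall h3)⟩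

end MemW012

theorem IsTestFunction.memW012 {φ : EuclideanSpace ℝ (Fin d) → ℝ} (h : IsTestFunction Ω φ) :
    MemW012 Ω φ (gradient φ) :=
  ⟨h.memLp 2, h.memLp_gradient 2, fun _ => φ, fun _ => h, by simp, by simp⟩

theorem inner_toLp {F : Type*} [NormedAddCommGroup F] [InnerProductSpace ℝ F]
    {μ : Measure (EuclideanSpace ℝ (Fin d))} {f g : EuclideanSpace ℝ (Fin d) → F}
    (hf : MemLp f 2 μ) (hg : MemLp g 2 μ) :
    inner ℝ (hf.toLp f) (hg.toLp g) = ∫ x, inner ℝ (f x) (g x) ∂μ := by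
  rw [L2.inner_def]
  refine integral_congr_ae ?_
  filter_upwards [hf.coeFn_toLp, hg.coeFn_toLp] with x h1 h2
  rw [h1, h2]

theorem tendsto_integral_inner {ι F : Type*} [NormedAddCommGroup F] [InnerProductSpace ℝ F]
    {l : Filter ι} {μ : Measure (EuclideanSpace ℝ (Fin d))}
    {u v : ι → EuclideanSpace ℝ (Fin d) → F} {f g : EuclideanSpace ℝ (Fin d) → F}
    (hu : ∀ n, MemLp (u n) 2 μ) (hv : ∀ n, MemLp (v n) 2 μ) (hf : MemLp f 2 μ)
    (hg : MemLp g 2 μ) (huf : Tendsto (fun n => eLpNorm (fun x => u n x - f x) 2 μ) l (𝓝 0))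
    (hvg : Tendsto (fun n => eLpNorm (fun x => v n x - g x) 2 μ) l (𝓝 0)) :
    Tendsto (fun n => ∫ x, inner ℝ (u n x) (v n x) ∂μ) l (𝓝 (∫ x, inner ℝ (f x) (g x) ∂μ)) := by
  simp_rw [← inner_toLp (hu _) (hv _)]
  rw [← inner_toLp hf hg]
  exact ((tendsto_toLp_iff hu hf).2 huf).inner ((tendsto_toLp_iff hv hg).2 hvg)

end EnergySpace

/-! ### Convergence in $L^2$. -/

section Convergence

variable {α F F' : Type*} [MeasurableSpace α] {μ : Measure α} [NormedAddCommGroup F]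
  [NormedAddCommGroup F']

theorem tendsto_eLpNorm_zero_of_dominated {u : ℕ → α → F} {b : α → ℝ}
    (hu : ∀ n, AEStronglyMeasurable (u n) μ) (hb : MemLp b 2 μ)
    (hub : ∀ n, ∀ᵐ x ∂μ, ‖u n x‖ ≤ b x) (hlim : ∀ᵐ x ∂μ, Tendsto (fun n => u n x) atTop (𝓝 0)) :
    Tendsto (fun n => eLpNorm (u n) 2 μ) atTop (𝓝 0) := by
  have key : Tendsto (fun n => ∫⁻ x, ‖u n x‖ₑ ^ (2 : ℝ) ∂μ) atTop (𝓝 (∫⁻ _, 0 ∂μ)) := by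
    refine tendsto_lintegral_of_dominated_convergence' (fun x => ‖b x‖ₑ ^ (2 : ℝ))
      (fun n => (hu n).enorm.pow_const _) (fun n => ?_) ?_ ?_
    · filter_upwards [hub n] with x hx
      refine ENNReal.rpow_le_rpow ?_ (by norm_num)
      exact enorm_le_iff_norm_le.2 (hx.trans (le_abs_self _))
    · have := lintegral_rpow_enorm_lt_top_of_eLpNorm_lt_top (by simp) (by simp) hb.2
      simpa using this.ne
    · filter_upwards [hlim] with x hx
      have h1 : Tendsto (fun n => ‖u n x‖ₑ) atTop (𝓝 0) := by
        simpa using hx.enorm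
      have h2 := (ENNReal.continuous_rpow_const (y := (2 : ℝ))).tendsto 0
      simpa [Function.comp_def] using h2.comp h1
  have h2 := (ENNReal.continuous_rpow_const (y := (1 / 2 : ℝ))).tendsto 0
  simp only [lintegral_zero] at key
  have h3 := h2.comp key
  rw [ENNReal.zero_rpow_of_pos (by norm_num)] at h3
  refine h3.congr fun n => ?_
  simp [eLpNorm_eq_lintegral_rpow_enorm_toReal]

theorem tendsto_eLpNorm_zero_of_le_mul {ι : Type*} {l : Filter ι} {u : ι → α → F} {v : ι → α → F'}
    (C : ℝ) (huv : ∀ n, ∀ᵐ x ∂μ, ‖u n x‖ ≤ C * ‖v n x‖)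
    (hv : Tendsto (fun n => eLpNorm (v n) 2 μ) l (𝓝 0)) :
    Tendsto (fun n => eLpNorm (u n) 2 μ) l (𝓝 0) := by
  have h := ENNReal.Tendsto.const_mul (a := ENNReal.ofReal C) hv (Or.inr ENNReal.ofReal_ne_top)
  rw [mul_zero] at h
  exact tendsto_of_tendsto_of_tendsto_of_le_of_le tendsto_const_nhds h (fun _ => zero_le)
    fun n => eLpNorm_le_mul_eLpNorm_of_ae_le_mul (huv n) 2

theorem tendsto_eLpNorm_zero_add {ι : Type*} {l : Filter ι} {u v : ι → α → F}
    (hum : ∀ n, AEStronglyMeasurable (u n) μ) (hvm : ∀ n, AEStronglyMeasurable (v n) μ)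
    (hu : Tendsto (fun n => eLpNorm (u n) 2 μ) l (𝓝 0))
    (hv : Tendsto (fun n => eLpNorm (v n) 2 μ) l (𝓝 0)) :
    Tendsto (fun n => eLpNorm (fun x => u n x + v n x) 2 μ) l (𝓝 0) := by
  have h := hu.add hv
  rw [add_zero] at h
  exact tendsto_of_tendsto_of_tendsto_of_le_of_le tendsto_const_nhds h (fun _ => zero_le)
    fun n => eLpNorm_add_le (hum n) (hvm n) (by norm_num)

theorem exists_subseq_tendsto_ae {u : ℕ → α → F} {f : α → F}
    (hu : ∀ n, AEStronglyMeasurable (u n) μ) (hf : AEStronglyMeasurable f μ)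
    (h : Tendsto (fun n => eLpNorm (fun x => u n x - f x) 2 μ) atTop (𝓝 0)) :
    ∃ ns : ℕ → ℕ, StrictMono ns ∧ ∀ᵐ x ∂μ, Tendsto (fun n => u (ns n) x) atTop (𝓝 (f x)) :=
  (tendstoInMeasure_of_tendsto_eLpNorm (by norm_num) hu hf h).exists_seq_tendsto_ae

end Convergence

/-! ### Admissibility of quotients of test functions by a positive continuous function. -/

section Reciprocal

theorem exists_smooth_eq_inv {a b : ℝ} (ha : 0 < a) (hab : a ≤ b) :
    ∃ θ : ℝ → ℝ, ContDiff ℝ ∞ θ ∧ HasCompactSupport θ ∧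
      ∀ t ∈ Icc a b, θ t = t⁻¹ ∧ deriv θ t = -(t ^ 2)⁻¹ := by
  -- The outer ball is $[a/2,\,b+a/2]$, which avoids $0$; the inner ball contains $[a,b]$ in its
  -- interior, so the derivatives agree there as well.
  let χ : ContDiffBump ((a + b) / 2) := ⟨(b - a) / 2 + a / 4, (b - a) / 2 + a / 2, by linarith,
    by linarith⟩
  have hsupp : ∀ t ∈ tsupport χ, 0 < t := by
    intro t ht
    rw [χ.tsupport_eq, Metric.mem_closedBall, Real.dist_eq] at ht
    have : |t - (a + b) / 2| ≤ (b - a) / 2 + a / 2 := ht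
    have := (abs_le.1 this).1
    linarith
  refine ⟨fun t => χ t * t⁻¹, ?_, χ.hasCompactSupport.mul_right, fun t ht => ?_⟩
  · refine contDiff_iff_contDiffAt.2 fun t => ?_
    by_cases ht : t ∈ tsupport χ
    · exact χ.contDiff.contDiffAt.mul (contDiffAt_inv ℝ (hsupp t ht).ne')
    · refine (contDiffAt_const (c := (0 : ℝ))).congr_of_eventuallyEq ?_
      filter_upwards [(isClosed_tsupport χ).isOpen_compl.mem_nhds ht] with s hs
      rw [image_eq_zero_of_notMem_tsupport hs, zero_mul]
  · have htb : t ∈ Metric.ball ((a + b) / 2) ((b - a) / 2 + a / 4) := by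
      rw [Metric.mem_ball, Real.dist_eq, abs_lt]
      constructor <;> linarith [ht.1, ht.2]
    have ev : (fun t => χ t * t⁻¹) =ᶠ[𝓝 t] fun t => t⁻¹ := by
      filter_upwards [χ.eventuallyEq_one_of_mem_ball htb] with s hs
      rw [hs]; simp
    refine ⟨ev.self_of_nhds, ?_⟩
    rw [ev.deriv_eq]
    simp

end Reciprocal

section Products

variable {d : ℕ} {Ω : Set (EuclideanSpace ℝ (Fin d))} {φ h w : EuclideanSpace ℝ (Fin d) → ℝ}
  {H U : EuclideanSpace ℝ (Fin d) → EuclideanSpace ℝ (Fin d)}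

/-- If test functions $\psi_n$ approximate $h$, then $\varphi\,\theta(\psi_n)$ are again test
functions and converge with their gradients. Boundedness of $\varphi$, $\theta$ and $\theta'$
supplies the majorants. -/
theorem MemW012.test_mul_comp {θ : ℝ → ℝ} (hφ : IsTestFunction Ω φ) (hθ : ContDiff ℝ ∞ θ)
    (hθc : HasCompactSupport θ) (hh : MemW012 Ω h H) :
    MemW012 Ω (fun x => φ x * θ (h x))
      (fun x => θ (h x) • gradient φ x + (φ x * deriv θ (h x)) • H x) := by
  obtain ⟨hh2, hH2, ψ, hψ, hlim, hlim'⟩ := hh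
  obtain ⟨ns, hns, hae⟩ := exists_subseq_tendsto_ae (fun n => ((hψ n).memLp 2).1) hh2.1 hlim
  replace hlim := hlim.comp hns.tendsto_atTop
  replace hlim' := hlim'.comp hns.tendsto_atTop
  have hθ1 : Continuous (deriv θ) := hθ.continuous_deriv (by simp)
  obtain ⟨A, hA⟩ := hθc.exists_bound_of_continuous hθ.continuous
  obtain ⟨B, hB⟩ := hθc.deriv.exists_bound_of_continuous hθ1
  obtain ⟨M, hM⟩ := hφ.2.1.exists_bound_of_continuous hφ.continuous
  have hA0 : 0 ≤ A := (norm_nonneg _).trans (hA 0)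
  have hB0 : 0 ≤ B := (norm_nonneg _).trans (hB 0)
  have hM0 : 0 ≤ M := (norm_nonneg _).trans (hM 0)
  have mφ : AEStronglyMeasurable φ (volume.restrict Ω) := (hφ.memLp 2).1
  have mφ' : AEStronglyMeasurable (gradient φ) (volume.restrict Ω) := (hφ.memLp_gradient 2).1
  have mψ := fun n => ((hψ n).memLp 2).1
  have mψ' := fun n => ((hψ n).memLp_gradient 2).1
  have mθ := hθ.continuous.comp_aestronglyMeasurable hh2.1
  have mθ' := hθ1.comp_aestronglyMeasurable hh2.1
  have mθn := fun n => hθ.continuous.comp_aestronglyMeasurable (mψ n)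
  have mθn' := fun n => hθ1.comp_aestronglyMeasurable (mψ n)
  have htest : ∀ n, IsTestFunction Ω (fun x => φ x * θ (ψ (ns n) x)) := fun n =>
    hφ.mul_left (hθ.comp (hψ (ns n)).1)
  refine MemW012.of_tendsto (fun n => (htest n).memW012) ?_ ?_ ?_ ?_
  · refine ((hφ.memLp 2).const_mul A).mono (mφ.mul mθ) (Eventually.of_forall fun x => ?_)
    rw [norm_mul, norm_mul, mul_comm, Real.norm_of_nonneg hA0]
    exact mul_le_mul_of_nonneg_right (hA _) (norm_nonneg _)
  · refine MemLp.add ?_ ?_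
    · refine ((hφ.memLp_gradient 2).const_smul A).mono (mθ.smul mφ')
        (Eventually.of_forall fun x => ?_)
      rw [Pi.smul_apply, norm_smul, norm_smul, Real.norm_of_nonneg hA0]
      exact mul_le_mul_of_nonneg_right (hA _) (norm_nonneg _)
    · refine (hH2.const_smul (M * B)).mono ((mφ.mul mθ').smul hH2.1)
        (Eventually.of_forall fun x => ?_)
      rw [Pi.smul_apply, norm_smul, norm_smul, Real.norm_of_nonneg (mul_nonneg hM0 hB0), norm_mul]
      exact mul_le_mul_of_nonneg_right (mul_le_mul (hM _) (hB _) (norm_nonneg _) hM0)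
        (norm_nonneg _)
  · refine tendsto_eLpNorm_zero_of_dominated (b := fun x => 2 * A * ‖φ x‖)
      (fun n => (mφ.mul (mθn _)).sub (mφ.mul mθ)) ((hφ.memLp 2).norm.const_mul _) ?_ ?_
    · refine fun n => Eventually.of_forall fun x => ?_
      rw [← mul_sub, norm_mul, mul_comm]
      refine mul_le_mul_of_nonneg_right ((norm_sub_le _ _).trans ?_) (norm_nonneg _)
      linarith [hA (ψ (ns n) x), hA (h x)]
    · filter_upwards [hae] with x hx
      have := ((hθ.continuous.tendsto _).comp hx).const_mul (φ x)
      simpa using this.sub_const (φ x * θ (h x))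
  -- Terms with a difference of $\theta$ or $\theta'$ tend to zero by dominated convergence along
  -- the a.e. convergent subsequence; the last term is controlled by the $L^2$ convergence of the
  -- gradients.
  · have e : ∀ n, (fun x => gradient (fun x => φ x * θ (ψ (ns n) x)) x -
        (θ (h x) • gradient φ x + (φ x * deriv θ (h x)) • H x)) = fun x =>
        ((θ (ψ (ns n) x) - θ (h x)) • gradient φ x +
          (φ x * (deriv θ (ψ (ns n) x) - deriv θ (h x))) • H x) +
          (φ x * deriv θ (ψ (ns n) x)) • (gradient (ψ (ns n)) x - H x) := by
      intro n
      ext1 x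
      rw [gradient_mul_comp_apply (hφ.differentiable x) ((hψ _).differentiable x)
        (hθ.differentiable (by simp) _)]
      module
    simp_rw [e]
    refine tendsto_eLpNorm_zero_add (fun n => ?_) (fun n => ?_)
      (tendsto_eLpNorm_zero_of_dominated
        (b := fun x => 2 * A * ‖gradient φ x‖ + (M * (2 * B)) * ‖H x‖) (fun n => ?_) ?_ ?_ ?_)
      (tendsto_eLpNorm_zero_of_le_mul (M * B) ?_ hlim')
    · exact (((mθn _).sub mθ).smul mφ').add ((mφ.mul ((mθn' _).sub mθ')).smul hH2.1)
    · exact (mφ.mul (mθn' _)).smul ((mψ' _).sub hH2.1)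
    · exact (((mθn _).sub mθ).smul mφ').add ((mφ.mul ((mθn' _).sub mθ')).smul hH2.1)
    · exact ((hφ.memLp_gradient 2).norm.const_mul _).add (hH2.norm.const_mul _)
    · refine fun n => Eventually.of_forall fun x => (norm_add_le _ _).trans ?_
      rw [norm_smul, norm_smul, norm_mul]
      gcongr
      · refine (norm_sub_le _ _).trans ?_
        linarith [hA (ψ (ns n) x), hA (h x)]
      · exact hM x
      · refine (norm_sub_le _ _).trans ?_
        linarith [hB (ψ (ns n) x), hB (h x)]
    · filter_upwards [hae] with x hx
      have h1 := (((hθ.continuous.tendsto _).comp hx).sub_const (θ (h x))).smul_const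
        (gradient φ x)
      have h2 := ((((hθ1.tendsto _).comp hx).sub_const (deriv θ (h x))).const_mul
        (φ x)).smul_const (H x)
      simpa using h1.add h2
    · refine fun n => Eventually.of_forall fun x => ?_
      rw [norm_smul, norm_mul]
      exact mul_le_mul_of_nonneg_right (mul_le_mul (hM _) (hB _) (norm_nonneg _) hM0)
        (norm_nonneg _)

/-- On the compact support of $\varphi$ the function $w$ takes values in some $[a,b]$ with $a>0$, so
there $1/w$ is a smooth compactly supported function of $w$. -/
theorem exists_smooth_eq_inv_comp (hφ : IsTestFunction Ω φ) (hw : ContinuousOn w Ω)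
    (hpos : ∀ x ∈ Ω, 0 < w x) :
    ∃ θ : ℝ → ℝ, ContDiff ℝ ∞ θ ∧ HasCompactSupport θ ∧
      ∀ x ∈ tsupport φ, θ (w x) = (w x)⁻¹ ∧ deriv θ (w x) = -(w x ^ 2)⁻¹ := by
  rcases (tsupport φ).eq_empty_or_nonempty with he | hne
  · exact ⟨0, contDiff_const, HasCompactSupport.zero, by simp [he]⟩
  have hc : IsCompact (tsupport φ) := hφ.2.1
  obtain ⟨x, hx, hmin⟩ := hc.exists_isMinOn hne (hw.mono hφ.2.2)
  obtain ⟨y, hy, hmax⟩ := hc.exists_isMaxOn hne (hw.mono hφ.2.2)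
  obtain ⟨θ, h1, h2, h3⟩ := exists_smooth_eq_inv (hpos x (hφ.2.2 hx)) (hmin hy)
  exact ⟨θ, h1, h2, fun z hz => h3 _ ⟨hmin hz, hmax hz⟩⟩

theorem IsTestFunction.eq_zero_of_notMem {x : EuclideanSpace ℝ (Fin d)}
    (hx : x ∉ tsupport φ) : φ x = 0 ∧ gradient φ x = 0 :=
  ⟨image_eq_zero_of_notMem_tsupport hx,
    image_eq_zero_of_notMem_tsupport fun h => hx (IsTestFunction.tsupport_gradient_subset h)⟩

theorem MemW012.test_div (hφ : IsTestFunction Ω φ) (hw : ContinuousOn w Ω)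
    (hpos : ∀ x ∈ Ω, 0 < w x) (hU : MemW012 Ω w U) :
    MemW012 Ω (fun x => φ x / w x)
      (fun x => (w x)⁻¹ • gradient φ x - (φ x / w x ^ 2) • U x) := by
  obtain ⟨θ, h1, h2, h3⟩ := exists_smooth_eq_inv_comp hφ hw hpos
  refine (MemW012.test_mul_comp hφ h1 h2 hU).congr (Eventually.of_forall fun x => ?_)
    (Eventually.of_forall fun x => ?_)
  all_goals
    by_cases hx : x ∈ tsupport φ
    · obtain ⟨e1, e2⟩ := h3 x hx
      simp only [e1, e2]
      first | rfl | (rw [sub_eq_add_neg, ← neg_smul]; congr 2; ring)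
    · obtain ⟨e1, e2⟩ := IsTestFunction.eq_zero_of_notMem hx
      simp [e1, e2]

theorem IsTestFunction.exists_bound_div (hφ : IsTestFunction Ω φ) (hw : ContinuousOn w Ω)
    (hpos : ∀ x ∈ Ω, 0 < w x) : ∃ C, ∀ x, ‖φ x / w x‖ ≤ C := by
  obtain ⟨θ, h1, h2, h3⟩ := exists_smooth_eq_inv_comp hφ hw hpos
  obtain ⟨A, hA⟩ := h2.exists_bound_of_continuous h1.continuous
  obtain ⟨M, hM⟩ := hφ.2.1.exists_bound_of_continuous hφ.continuous
  refine ⟨M * A, fun x => ?_⟩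
  by_cases hx : x ∈ tsupport φ
  · rw [div_eq_mul_inv, norm_mul, ← (h3 x hx).1]
    exact mul_le_mul (hM _) (hA _) (norm_nonneg _) ((norm_nonneg _).trans (hM 0))
  · rw [(IsTestFunction.eq_zero_of_notMem hx).1]
    simpa using mul_nonneg ((norm_nonneg _).trans (hM 0)) ((norm_nonneg _).trans (hA 0))

end Products

/-! ### The ground state representation. -/

section Representation

section SquareIntegrable

variable {d : ℕ} {F : Type*} [NormedAddCommGroup F] [InnerProductSpace ℝ F]
  {μ : Measure (EuclideanSpace ℝ (Fin d))} {f g : EuclideanSpace ℝ (Fin d) → F}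

theorem integrable_inner_of_memLp (hf : MemLp f 2 μ) (hg : MemLp g 2 μ) :
    Integrable (fun x => inner ℝ (f x) (g x)) μ := by
  refine (L2.integrable_inner (𝕜 := ℝ) (hf.toLp f) (hg.toLp g)).congr ?_
  filter_upwards [hf.coeFn_toLp, hg.coeFn_toLp] with x h1 h2
  rw [h1, h2]

theorem norm_toLp_sq (hf : MemLp f 2 μ) : ‖hf.toLp f‖ ^ 2 = ∫ x, ‖f x‖ ^ 2 ∂μ := by
  rw [← real_inner_self_eq_norm_sq, inner_toLp hf hf]
  simp_rw [real_inner_self_eq_norm_sq]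

theorem integrable_norm_sq (hf : MemLp f 2 μ) : Integrable (fun x => ‖f x‖ ^ 2) μ := by
  simpa [real_inner_self_eq_norm_sq] using integrable_inner_of_memLp hf hf

end SquareIntegrable

variable {d : ℕ} {Ω : Set (EuclideanSpace ℝ (Fin d))} {φ ψ f h w : EuclideanSpace ℝ (Fin d) → ℝ}
  {F H U : EuclideanSpace ℝ (Fin d) → EuclideanSpace ℝ (Fin d)}

theorem IsTestFunction.integral_mul_gradient (hφ : IsTestFunction Ω φ) (hψ : IsTestFunction Ω ψ)
    (v : EuclideanSpace ℝ (Fin d)) :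
    ∫ x in Ω, inner ℝ (φ x • v) (gradient ψ x) = -∫ x in Ω, inner ℝ (ψ x • v) (gradient φ x) := by
  have hz : ∀ {χ : EuclideanSpace ℝ (Fin d) → ℝ}, IsTestFunction Ω χ → ∀ x ∉ Ω, χ x = 0 :=
    fun hχ x hx => image_eq_zero_of_notMem_tsupport fun hx' => hx (hχ.2.2 hx')
  rw [setIntegral_eq_integral_of_forall_compl_eq_zero, setIntegral_eq_integral_of_forall_compl_eq_zero]
  · have key := integral_mul_fderiv_eq_neg_fderiv_mul_of_integrable (μ := volume) (f := φ) (g := ψ)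
      (v := v) ?_ ?_ ?_ (fun x _ => hφ.differentiable x) (fun x _ => hψ.differentiable x)
    · simp only [inner_gradient_right, conj_trivial, map_smul, smul_eq_mul]
      rw [key]
      simp_rw [mul_comm (ψ _)]
    · exact (((hφ.1.continuous_fderiv (by simp)).clm_apply continuous_const).mul
        hψ.continuous).integrable_of_hasCompactSupport hψ.2.1.mul_left
    · exact (hφ.continuous.mul ((hψ.1.continuous_fderiv (by simp)).clm_apply
        continuous_const)).integrable_of_hasCompactSupport hφ.2.1.mul_right
    · exact (hφ.continuous.mul hψ.continuous).integrable_of_hasCompactSupport hφ.2.1.mul_right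
  · intro x hx
    simp [hz hψ x hx]
  · intro x hx
    simp [hz hφ x hx]

theorem MemW012.integral_mul_gradient (hf : MemW012 Ω f F) (hh : MemW012 Ω h H)
    (v : EuclideanSpace ℝ (Fin d)) :
    ∫ x in Ω, inner ℝ (f x • v) (H x) = -∫ x in Ω, inner ℝ (h x • v) (F x) := by
  obtain ⟨hf2, hF2, φ, hφ, h1, h1'⟩ := hf
  obtain ⟨hh2, hH2, ψ, hψ, h2, h2'⟩ := hh
  have smulv : ∀ {u : ℕ → EuclideanSpace ℝ (Fin d) → ℝ} {f : EuclideanSpace ℝ (Fin d) → ℝ},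
      Tendsto (fun n => eLpNorm (fun x => u n x - f x) 2 (volume.restrict Ω)) atTop (𝓝 0) →
      Tendsto (fun n => eLpNorm (fun x => u n x • v - f x • v) 2 (volume.restrict Ω)) atTop
        (𝓝 0) := by
    intro u f hu
    refine tendsto_eLpNorm_zero_of_le_mul ‖v‖ (fun n => Eventually.of_forall fun x => ?_) hu
    rw [← sub_smul, norm_smul, mul_comm]
  have mv : ∀ {f : EuclideanSpace ℝ (Fin d) → ℝ}, MemLp f 2 (volume.restrict Ω) →
      MemLp (fun x => f x • v) 2 (volume.restrict Ω) := by
    intro f hf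
    refine (hf.const_mul ‖v‖).mono (hf.1.smul_const v) (Eventually.of_forall fun x => ?_)
    rw [norm_smul, norm_mul, norm_norm, mul_comm]
  have t1 := tendsto_integral_inner (fun n => mv ((hφ n).memLp 2))
    (fun n => (hψ n).memLp_gradient 2) (mv hf2) hH2 (smulv h1) h2'
  have t2 := tendsto_integral_inner (fun n => mv ((hψ n).memLp 2))
    (fun n => (hφ n).memLp_gradient 2) (mv hh2) hF2 (smulv h2) h1'
  refine tendsto_nhds_unique t1 (t2.neg.congr fun n => ?_)
  rw [(hφ n).integral_mul_gradient (hψ n)]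

section GroundStateRepresentation

variable {lam : ℝ}

theorem MemW012.exists_seq_ae (hf : MemW012 Ω f F) :
    ∃ φ : ℕ → EuclideanSpace ℝ (Fin d) → ℝ, (∀ n, IsTestFunction Ω (φ n)) ∧
      Tendsto (fun n => eLpNorm (fun x => φ n x - f x) 2 (volume.restrict Ω)) atTop (𝓝 0) ∧
      Tendsto (fun n => eLpNorm (fun x => gradient (φ n) x - F x) 2 (volume.restrict Ω))
        atTop (𝓝 0) ∧
      (∀ᵐ x ∂volume.restrict Ω, Tendsto (fun n => φ n x) atTop (𝓝 (f x))) ∧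
      ∀ᵐ x ∂volume.restrict Ω, Tendsto (fun n => gradient (φ n) x) atTop (𝓝 (F x)) := by
  obtain ⟨hf2, hF2, φ, hφ, h1, h1'⟩ := hf
  obtain ⟨ns, hns, h2⟩ := exists_subseq_tendsto_ae (fun n => ((hφ n).memLp 2).1) hf2.1 h1
  obtain ⟨ms, hms, h3⟩ := exists_subseq_tendsto_ae
    (fun n => ((hφ (ns n)).memLp_gradient 2).1) hF2.1 (h1'.comp hns.tendsto_atTop)
  refine ⟨fun n => φ (ns (ms n)), fun n => hφ _, h1.comp (hns.comp hms).tendsto_atTop,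
    h1'.comp (hns.comp hms).tendsto_atTop, ?_, h3⟩
  filter_upwards [h2] with x hx using hx.comp hms.tendsto_atTop

theorem IsTestFunction.memLp_sub_div_smul (hφ : IsTestFunction Ω φ) (hw : ContinuousOn w Ω)
    (hpos : ∀ x ∈ Ω, 0 < w x) (hU : MemW012 Ω w U) :
    MemLp (fun x => gradient φ x - (φ x / w x) • U x) 2 (volume.restrict Ω) := by
  obtain ⟨C, hC⟩ := hφ.exists_bound_div hw hpos
  refine (hφ.memLp_gradient 2).sub ((hU.2.1.const_smul C).mono ?_ (Eventually.of_forall fun x => ?_))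
  · exact ((hφ.memLp 2).1.aemeasurable.div hU.1.1.aemeasurable).aestronglyMeasurable.smul hU.2.1.1
  · rw [Pi.smul_apply, norm_smul, norm_smul]
    exact mul_le_mul_of_nonneg_right ((hC x).trans (le_abs_self C)) (norm_nonneg _)

theorem IsTestFunction.integral_norm_sq_sub (hφ : IsTestFunction Ω φ) (hw : ContinuousOn w Ω)
    (hpos : ∀ x ∈ Ω, 0 < w x) (hΩ : MeasurableSet Ω) (hU : MemW012 Ω w U)
    (heq : ∀ v V, MemW012 Ω v V →
      ∫ x in Ω, inner ℝ (U x) (V x) = lam * ∫ x in Ω, w x * v x) :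
    ∫ x in Ω, ‖gradient φ x - (φ x / w x) • U x‖ ^ 2 =
      (∫ x in Ω, ‖gradient φ x‖ ^ 2) - lam * ∫ x in Ω, φ x ^ 2 := by
  -- The equation for $w$ is tested with $\varphi^2/w$, whose gradient is
  -- $2(\varphi/w)\nabla\varphi-(\varphi/w)^2U$; this completes the square.
  have hφ2 : IsTestFunction Ω (fun x => φ x * φ x) := hφ.mul_left hφ.1
  have hV := MemW012.test_div hφ2 hw hpos hU
  have h := heq _ _ hV
  have e : ∫ x in Ω, w x * (φ x * φ x / w x) = ∫ x in Ω, φ x ^ 2 := by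
    refine setIntegral_congr_fun hΩ fun x hx => ?_
    have := (hpos x hx).ne'
    field_simp
  rw [e] at h
  rw [← h, ← integral_sub (integrable_norm_sq (hφ.memLp_gradient 2))
    (integrable_inner_of_memLp hU.2.1 hV.2.1)]
  refine setIntegral_congr_fun hΩ fun x hx => ?_
  have hx0 := (hpos x hx).ne'
  have hg : gradient (fun y => φ y * φ y) x = (2 * φ x) • gradient φ x := by
    have := gradient_mul_comp_apply (θ := id) (hφ.differentiable x) (hφ.differentiable x)
      differentiableAt_id
    simp only [id, deriv_id, mul_one] at this
    rw [this]
    module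
  simp only [hg]
  rw [norm_sub_sq_real, inner_sub_right, norm_smul, mul_pow, real_inner_smul_right,
    real_inner_smul_right, real_inner_smul_right, real_inner_smul_right,
    real_inner_self_eq_norm_sq, real_inner_comm (U x), Real.norm_eq_abs, sq_abs]
  field_simp
  ring

/-- Nothing controls $(f/w)U$ near the boundary a priori. Its square integrability after subtraction
from $F$ comes from the identity for test functions. -/
theorem MemW012.sub_div_smul (hf : MemW012 Ω f F) (hw : ContinuousOn w Ω)
    (hpos : ∀ x ∈ Ω, 0 < w x) (hΩ : MeasurableSet Ω) (hU : MemW012 Ω w U) (hlam : 0 ≤ lam)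
    (heq : ∀ v V, MemW012 Ω v V →
      ∫ x in Ω, inner ℝ (U x) (V x) = lam * ∫ x in Ω, w x * v x) :
    MemLp (fun x => F x - (f x / w x) • U x) 2 (volume.restrict Ω) ∧
    ∫ x in Ω, ‖F x - (f x / w x) • U x‖ ^ 2 =
      (∫ x in Ω, ‖F x‖ ^ 2) - lam * ∫ x in Ω, f x ^ 2 := by
  obtain ⟨φ, hφ, h1, h1', h2, h2'⟩ := hf.exists_seq_ae
  obtain ⟨hf2, hF2, -⟩ := hf
  have mR := fun n => (hφ n).memLp_sub_div_smul hw hpos hU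
  have hp := (tendsto_toLp_iff (fun n => (hφ n).memLp_gradient 2) hF2).2 h1'
  have hq := (tendsto_toLp_iff (fun n => (hφ n).memLp 2) hf2).2 h1
  -- The expression is linear in $\varphi$, so the identity applies to differences; since
  -- $\lambda\ge0$, its norm is at most that of the gradient.
  have hcauchy : CauchySeq fun n => (mR n).toLp _ := by
    have hpc := cauchySeq_iff_tendsto_dist_atTop_0.1 hp.cauchySeq
    refine cauchySeq_iff_tendsto_dist_atTop_0.2 (squeeze_zero (fun _ => dist_nonneg)
      (fun n => ?_) hpc)
    have hd := (hφ n.1).sub (hφ n.2)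
    rw [dist_eq_norm, dist_eq_norm, ← MemLp.toLp_sub, ← MemLp.toLp_sub]
    refine abs_le_of_sq_le_sq' ?_ (norm_nonneg _) |>.2
    rw [norm_toLp_sq, norm_toLp_sq]
    have key := hd.integral_norm_sq_sub hw hpos hΩ hU heq
    simp_rw [(hφ n.1).gradient_sub (hφ n.2)] at key
    have e : ∀ x, gradient (φ n.1) x - gradient (φ n.2) x - ((φ n.1 x - φ n.2 x) / w x) • U x
        = (gradient (φ n.1) x - (φ n.1 x / w x) • U x) -
          (gradient (φ n.2) x - (φ n.2 x / w x) • U x) := by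
      intro x
      rw [sub_div]
      module
    simp_rw [e] at key
    simp only [Pi.sub_apply]
    rw [key]
    have : 0 ≤ lam * ∫ x in Ω, (φ n.1 x - φ n.2 x) ^ 2 :=
      mul_nonneg hlam (integral_nonneg fun x => sq_nonneg _)
    linarith
  obtain ⟨R, hR⟩ := cauchySeq_tendsto_of_complete hcauchy
  have hR' : Tendsto (fun n => eLpNorm (fun x => (gradient (φ n) x - (φ n x / w x) • U x) - R x) 2
      (volume.restrict Ω)) atTop (𝓝 0) := by
    rw [← Lp.toLp_coeFn R (Lp.memLp R)] at hR
    exact (tendsto_toLp_iff mR (Lp.memLp R)).1 hR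
  obtain ⟨ns, hns, h3⟩ := exists_subseq_tendsto_ae (fun n => (mR n).1) (Lp.memLp R).1 hR'
  -- The abstract $L^2$ limit is identified through a.e. convergence, $1/w$ and $U$ being fixed.
  have hae : R =ᵐ[volume.restrict Ω] fun x => F x - (f x / w x) • U x := by
    filter_upwards [h2, h2', h3] with x hx hx' hx3
    exact tendsto_nhds_unique hx3
      ((hx'.sub ((hx.div_const _).smul_const _)).comp hns.tendsto_atTop)
  have hmem := (Lp.memLp R).ae_eq hae
  refine ⟨hmem, ?_⟩
  rw [← norm_toLp_sq hmem, ← norm_toLp_sq hF2]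
  have e2 : ∫ x in Ω, f x ^ 2 = ‖hf2.toLp f‖ ^ 2 := by
    rw [norm_toLp_sq]
    simp
  have eR : hmem.toLp _ = R := by
    rw [← Lp.toLp_coeFn R (Lp.memLp R)]
    exact MemLp.toLp_congr _ _ hae.symm
  rw [e2, eR]
  refine tendsto_nhds_unique (hR.norm.pow 2) (((hp.norm.pow 2).sub
    ((hq.norm.pow 2).const_mul lam)).congr fun n => ?_)
  rw [norm_toLp_sq, norm_toLp_sq, norm_toLp_sq, (hφ n).integral_norm_sq_sub hw hpos hΩ hU heq]
  simp

theorem locallyIntegrableOn_of_memLp {F : Type*} [NormedAddCommGroup F]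
    {u : EuclideanSpace ℝ (Fin d) → F} (hu : MemLp u 2 (volume.restrict Ω)) :
    LocallyIntegrableOn u Ω volume :=
  locallyIntegrableOn_of_locallyIntegrable_restrict (hu.locallyIntegrable (by norm_num))

/-- Integration by parts is applied to the pair $f$ and $\varphi/w$, both in $W_0^{1,2}$; the term
$f\varphi w^{-2}U$ from the quotient rule moves to the other side. -/
theorem MemW012.hasWeakGradient_div (hf : MemW012 Ω f F) (hw : ContinuousOn w Ω)
    (hpos : ∀ x ∈ Ω, 0 < w x) (hΩ : IsOpen Ω) (hU : MemW012 Ω w U)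
    (hR : MemLp (fun x => F x - (f x / w x) • U x) 2 (volume.restrict Ω)) :
    HasWeakGradient Ω (fun x => f x / w x) (fun x => (w x)⁻¹ • (F x - (f x / w x) • U x)) := by
  have hwi : ContinuousOn (fun x => (w x)⁻¹) Ω := hw.inv₀ fun x hx => (hpos x hx).ne'
  refine ⟨?_, ?_, fun φ hφ v => ?_⟩
  · have := (locallyIntegrableOn_of_memLp hf.1).continuousOn_mul hwi hΩ.isLocallyClosed
    simpa [div_eq_inv_mul] using this
  · exact (locallyIntegrableOn_of_memLp hR).continuousOn_smul hΩ.isLocallyClosed hwi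
  · have hV := MemW012.test_div hφ hw hpos hU
    have key := hf.integral_mul_gradient hV v
    obtain ⟨C, hC⟩ := hφ.exists_bound_div (hw.pow 2) (fun x hx => pow_pos (hpos x hx) 2)
    have mUv : MemLp (fun x => (φ x / w x ^ 2) * inner ℝ (U x) v) 2 (volume.restrict Ω) := by
      refine ((hU.2.1.inner_const (𝕜 := ℝ) v).const_mul C).mono ?_ (Eventually.of_forall fun x => ?_)
      · exact ((hφ.memLp 2).1.aemeasurable.div
          (hU.1.1.aemeasurable.pow_const 2)).aestronglyMeasurable.mul (hU.2.1.inner_const (𝕜 := ℝ) v).1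
      · rw [norm_mul, norm_mul]
        exact mul_le_mul_of_nonneg_right ((hC x).trans (le_abs_self C)) (norm_nonneg _)
    have mfv : MemLp (fun x => f x • v) 2 (volume.restrict Ω) :=
      (hf.1.const_mul ‖v‖).mono (hf.1.1.smul_const v) (Eventually.of_forall fun x => by
        rw [norm_smul, norm_mul, norm_norm, mul_comm])
    have mhv : MemLp (fun x => (φ x / w x) • v) 2 (volume.restrict Ω) :=
      (hV.1.const_mul ‖v‖).mono (hV.1.1.smul_const v) (Eventually.of_forall fun x => by
        rw [norm_smul, norm_mul, norm_norm, mul_comm])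
    have i1 := integrable_inner_of_memLp mfv hV.2.1
    have i2 : Integrable (fun x => f x * ((φ x / w x ^ 2) * inner ℝ (U x) v))
      (volume.restrict Ω) := hf.1.integrable_mul mUv
    have i3 := integrable_inner_of_memLp mhv hf.2.1
    have e1 : ∫ x in Ω, f x / w x * inner ℝ (gradient φ x) v =
        (∫ x in Ω, inner ℝ (f x • v) ((w x)⁻¹ • gradient φ x - (φ x / w x ^ 2) • U x)) +
          ∫ x in Ω, f x * ((φ x / w x ^ 2) * inner ℝ (U x) v) := by
      rw [← integral_add i1 i2]
      refine integral_congr_ae (Eventually.of_forall fun x => ?_)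
      simp only [real_inner_smul_left, inner_sub_right, real_inner_smul_right,
        real_inner_comm v]
      ring
    have e2 : ∫ x in Ω, φ x * inner ℝ ((w x)⁻¹ • (F x - (f x / w x) • U x)) v =
        (∫ x in Ω, inner ℝ ((φ x / w x) • v) (F x)) -
          ∫ x in Ω, f x * ((φ x / w x ^ 2) * inner ℝ (U x) v) := by
      rw [← integral_sub i3 i2]
      refine integral_congr_ae (Eventually.of_forall fun x => ?_)
      simp only [real_inner_comm v, real_inner_smul_left, real_inner_smul_right, inner_sub_right]
      ring
    rw [e1, e2, key]
    ring

end GroundStateRepresentation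

end Representation

/-! ### Uniqueness of weak gradients; functions with vanishing weak gradient. -/

section WeakGradient

variable {d : ℕ} {Ω : Set (EuclideanSpace ℝ (Fin d))} {φ g : EuclideanSpace ℝ (Fin d) → ℝ}
  {G G' : EuclideanSpace ℝ (Fin d) → EuclideanSpace ℝ (Fin d)}

theorem IsTestFunction.integrableOn_smul {F : Type*} [NormedAddCommGroup F] [NormedSpace ℝ F]
    {u : EuclideanSpace ℝ (Fin d) → F} (hφ : IsTestFunction Ω φ) (hΩ : MeasurableSet Ω)
    (hu : LocallyIntegrableOn u Ω volume) : IntegrableOn (fun x => φ x • u x) Ω := by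
  have hK : IsCompact (tsupport φ) := hφ.2.1
  refine (((hu.mono_set hφ.2.2).integrableOn_isCompact hK).continuousOn_smul
    hφ.continuous.continuousOn hK).of_forall_sdiff_eq_zero hΩ fun x hx => ?_
  rw [image_eq_zero_of_notMem_tsupport hx.2, zero_smul]

theorem HasWeakGradient.unique (hΩ : IsOpen Ω) (h : HasWeakGradient Ω g G)
    (h' : HasWeakGradient Ω g G') : G =ᵐ[volume.restrict Ω] G' := by
  have key : ∀ᵐ x ∂volume, x ∈ Ω → (G - G') x = 0 := by
    refine hΩ.ae_eq_zero_of_integral_contDiff_smul_eq_zero (h.2.1.sub h'.2.1)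
      fun φ hφ1 hφ2 hφ3 => ?_
    have hφ : IsTestFunction Ω φ := ⟨hφ1, hφ2, hφ3⟩
    have i1 := hφ.integrableOn_smul hΩ.measurableSet h.2.1
    have i2 := hφ.integrableOn_smul hΩ.measurableSet h'.2.1
    rw [← setIntegral_eq_integral_of_forall_compl_eq_zero (s := Ω)]
    · simp only [Pi.sub_apply, smul_sub]
      rw [integral_sub i1 i2, sub_eq_zero]
      refine ext_inner_left ℝ fun v => ?_
      rw [← integral_inner i1, ← integral_inner i2]
      simp only [real_inner_smul_right]
      have e1 := h.2.2 φ hφ v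
      have e2 := h'.2.2 φ hφ v
      simp only [real_inner_comm v] at e1 e2
      rw [e1] at e2
      exact neg_injective e2
    · intro x hx
      rw [image_eq_zero_of_notMem_tsupport fun h => hx (hφ3 h), zero_smul]
  rw [EventuallyEq, ae_restrict_iff' hΩ.measurableSet]
  filter_upwards [key] with x hx hxΩ
  exact sub_eq_zero.1 (hx hxΩ)

/-- The derivative falls on the mollifier, and $t\mapsto\eta(x-t)$ is a test function supported in
the ball of radius $2r$, so the hypothesis says that the derivative vanishes. -/
theorem hasFDerivAt_convolution_zero {r : ℝ} {x₀ : EuclideanSpace ℝ (Fin d)}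
    (hr : Metric.closedBall x₀ (2 * r) ⊆ Ω) (hg : LocallyIntegrableOn g Ω volume)
    (h : ∀ φ, IsTestFunction Ω φ → ∀ v, ∫ x in Ω, g x * inner ℝ (gradient φ x) v = 0)
    (η : ContDiffBump (0 : EuclideanSpace ℝ (Fin d))) (hη : η.rOut ≤ r)
    {x : EuclideanSpace ℝ (Fin d)} (hx : x ∈ Metric.ball x₀ r) :
    HasFDerivAt (convolution (η.normed volume) ((Metric.closedBall x₀ (2 * r)).indicator g)
      (ContinuousLinearMap.lsmul ℝ ℝ) volume)
      (0 : EuclideanSpace ℝ (Fin d) →L[ℝ] ℝ) x := by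
  set B := Metric.closedBall x₀ (2 * r)
  have hB : IsCompact B := isCompact_closedBall _ _
  have hgB : LocallyIntegrable (B.indicator g) volume :=
    (((hg.mono_set hr).integrableOn_isCompact hB).integrable_indicator
      hB.measurableSet).locallyIntegrable
  have hη1 : ContDiff ℝ 1 (η.normed volume) := η.contDiff_normed (n := 1)
  have hηc := η.hasCompactSupport_normed (μ := (volume : Measure (EuclideanSpace ℝ (Fin d))))
  rw [← convolution_flip]
  have hd := hηc.hasFDerivAt_convolution_right (ContinuousLinearMap.lsmul ℝ ℝ).flip hgB hη1 x
  refine hd.congr_fderiv (ContinuousLinearMap.ext fun v => ?_)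
  rw [convolution_precompR_apply _ hgB (hηc.fderiv (𝕜 := ℝ)) (hη1.continuous_fderiv (by simp))]
  let ψ : EuclideanSpace ℝ (Fin d) → ℝ := fun t => η.normed volume (x - t)
  have hsupp : tsupport ψ ⊆ Metric.closedBall x r := by
    refine closure_minimal (fun t ht => ?_) Metric.isClosed_closedBall
    have : x - t ∈ tsupport (η.normed volume) := subset_tsupport _ ht
    rw [η.tsupport_normed_eq, mem_closedBall_zero_iff] at this
    rw [Metric.mem_closedBall, dist_comm, dist_eq_norm]
    exact this.trans hη
  have hsuppB : tsupport ψ ⊆ B := hsupp.trans (Metric.closedBall_subset_closedBall' (by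
    have := Metric.mem_ball.1 hx
    linarith))
  have hψ : IsTestFunction Ω ψ := by
    refine ⟨?_, ?_, hsuppB.trans hr⟩
    · exact (η.contDiff_normed (n := ⊤)).comp (contDiff_const.sub contDiff_id)
    · exact (isCompact_closedBall x r).of_isClosed_subset (isClosed_tsupport _) hsupp
  have key := h ψ hψ v
  rw [convolution_def]
  have hgrad : ∀ t, inner ℝ (gradient ψ t) v = -fderiv ℝ (η.normed volume) (x - t) v := by
    intro t
    rw [inner_gradient_left]
    have h1 : HasFDerivAt (fun t => x - t) (-ContinuousLinearMap.id ℝ _) t :=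
      (hasFDerivAt_id t).const_sub x
    have h2 := ((hη1.differentiable (by simp)) (x - t)).hasFDerivAt.comp t h1
    have h3 : fderiv ℝ ψ t = _ := h2.fderiv
    rw [h3]
    simp
  rw [setIntegral_eq_integral_of_forall_compl_eq_zero] at key
  · have e : ∀ t, ((ContinuousLinearMap.lsmul ℝ ℝ).flip (B.indicator g t))
        (fderiv ℝ (η.normed volume) (x - t) v) = -(g t * inner ℝ (gradient ψ t) v) := by
      intro t
      by_cases ht : t ∈ B
      · rw [indicator_of_mem ht, hgrad]
        simp [mul_comm]
      · have : gradient ψ t = 0 :=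
          (IsTestFunction.eq_zero_of_notMem fun h => ht (hsuppB h)).2
        rw [this, indicator_of_notMem ht]
        simp
    simp_rw [e]
    rw [integral_neg, key]
    simp
  · intro t ht
    rw [(IsTestFunction.eq_zero_of_notMem fun h => ht (hψ.2.2 h)).2]
    simp

/-- The mollifications are constant on the ball and converge to $g$ almost everywhere. -/
theorem exists_ball_ae_const (hΩ : IsOpen Ω) (hg : LocallyIntegrableOn g Ω volume)
    (h : ∀ φ, IsTestFunction Ω φ → ∀ v, ∫ x in Ω, g x * inner ℝ (gradient φ x) v = 0)
    {x₀ : EuclideanSpace ℝ (Fin d)} (hx₀ : x₀ ∈ Ω) :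
    ∃ r c, 0 < r ∧ ∀ᵐ x, x ∈ Metric.ball x₀ r → g x = c := by
  obtain ⟨ε, hε, hεΩ⟩ := Metric.nhds_basis_closedBall.mem_iff.1 (hΩ.mem_nhds hx₀)
  obtain ⟨r, hr, rfl⟩ : ∃ r, 0 < r ∧ ε = 2 * r := ⟨ε / 2, by linarith, by ring⟩
  let η : ℕ → ContDiffBump (0 : EuclideanSpace ℝ (Fin d)) := fun n =>
    ⟨r / (n + 1) / 2, r / (n + 1), by positivity, half_lt_self (by positivity)⟩
  have hB : IsCompact (Metric.closedBall x₀ (2 * r)) := isCompact_closedBall _ _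
  have hgB : LocallyIntegrable ((Metric.closedBall x₀ (2 * r)).indicator g) volume :=
    (((hg.mono_set hεΩ).integrableOn_isCompact hB).integrable_indicator
      hB.measurableSet).locallyIntegrable
  have hlim : Tendsto (fun n => (η n).rOut) atTop (𝓝 0) := by
    have := (tendsto_one_div_add_atTop_nhds_zero_nat (𝕜 := ℝ)).const_mul r
    simpa [η, div_eq_mul_inv] using this
  have hae := ContDiffBump.ae_convolution_tendsto_right_of_locallyIntegrable (K := 2) hlim
    (Eventually.of_forall fun n => by simp only [η]; linarith) hgB
  have hηr : ∀ n, (η n).rOut ≤ r := fun n => div_le_self hr.le (by simp)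
  have hconst : ∀ n, ∀ x ∈ Metric.ball x₀ r, ∀ y ∈ Metric.ball x₀ r,
      convolution ((η n).normed volume) ((Metric.closedBall x₀ (2 * r)).indicator g)
        (ContinuousLinearMap.lsmul ℝ ℝ) volume x =
      convolution ((η n).normed volume) ((Metric.closedBall x₀ (2 * r)).indicator g)
        (ContinuousLinearMap.lsmul ℝ ℝ) volume y := fun n x hx y hy =>
    Metric.isOpen_ball.is_const_of_fderiv_eq_zero (𝕜 := ℝ) (convex_ball x₀ r).isPreconnected
      (fun z hz => (hasFDerivAt_convolution_zero hεΩ hg h (η n) (hηr n)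
        hz).differentiableAt.differentiableWithinAt)
      (fun z hz => (hasFDerivAt_convolution_zero hεΩ hg h (η n) (hηr n) hz).fderiv) hx hy
  have hne : (volume.restrict (Metric.ball x₀ r)) ≠ 0 := by
    rw [Ne, Measure.restrict_eq_zero]
    exact (Metric.measure_ball_pos volume x₀ hr).ne'
  have hnb := ae_neBot.2 hne
  obtain ⟨y, hy, hyB⟩ := ((ae_restrict_of_ae hae).and
    (ae_restrict_mem (Metric.isOpen_ball (x := x₀) (ε := r)).measurableSet)).exists
  have hin : ∀ x ∈ Metric.ball x₀ r, (Metric.closedBall x₀ (2 * r)).indicator g x = g x :=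
    fun x hx => indicator_of_mem (Metric.closedBall_subset_closedBall (by linarith)
      (Metric.ball_subset_closedBall hx)) g
  refine ⟨r, g y, hr, ?_⟩
  filter_upwards [hae] with x hx hxB
  rw [hin x hxB] at hx
  rw [hin y hyB] at hy
  exact tendsto_nhds_unique hx (hy.congr fun n => hconst n y hyB x hxB)

theorem ae_const_of_weakGradient_eq_zero (hΩ : IsOpen Ω) (hΩc : IsPreconnected Ω)
    (hg : LocallyIntegrableOn g Ω volume)
    (h : ∀ φ, IsTestFunction Ω φ → ∀ v, ∫ x in Ω, g x * inner ℝ (gradient φ x) v = 0) :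
    ∃ c, ∀ᵐ x ∂volume.restrict Ω, g x = c := by
  rcases Ω.eq_empty_or_nonempty with rfl | ⟨x₁, hx₁⟩
  · exact ⟨0, by simp⟩
  choose! r c hr hc using fun x (hx : x ∈ Ω) => exists_ball_ae_const hΩ hg h hx
  have hloc : IsLocallyConstant fun x : Ω => c x := by
    rw [IsLocallyConstant.iff_eventually_eq]
    rintro ⟨x, hx⟩
    have hb : Subtype.val ⁻¹' Metric.ball x (r x) ∈ 𝓝 (⟨x, hx⟩ : Ω) :=
      continuous_subtype_val.continuousAt.preimage_mem_nhds (Metric.ball_mem_nhds x (hr x hx))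
    filter_upwards [hb] with y hy
    -- The overlap of two balls is a nonempty open set, hence of positive measure, so the two
    -- constants agree at a common good point.
    have hopen : IsOpen (Metric.ball x (r x) ∩ Metric.ball (y : EuclideanSpace ℝ (Fin d)) (r y)) :=
      Metric.isOpen_ball.inter Metric.isOpen_ball
    have hne : volume.restrict (Metric.ball x (r x) ∩ Metric.ball (y : EuclideanSpace ℝ (Fin d))
        (r y)) ≠ 0 := by
      rw [Ne, Measure.restrict_eq_zero]
      exact (hopen.measure_pos volume ⟨y, hy, Metric.mem_ball_self (hr y y.2)⟩).ne'
    have hnb := ae_neBot.2 hne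
    obtain ⟨z, ⟨hz1, hz2⟩, hz3⟩ := (((ae_restrict_of_ae (hc x hx)).and
      (ae_restrict_of_ae (hc y y.2))).and (ae_restrict_mem hopen.measurableSet)).exists
    exact (hz2 hz3.2).symm.trans (hz1 hz3.1)
  have : PreconnectedSpace Ω := isPreconnected_iff_preconnectedSpace.1 hΩc
  have hcc : ∀ x ∈ Ω, c x = c x₁ := fun x hx =>
    hloc.apply_eq_of_preconnectedSpace ⟨x, hx⟩ ⟨x₁, hx₁⟩
  refine ⟨c x₁, ?_⟩
  rw [ae_restrict_iff' hΩ.measurableSet, ae_iff]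
  refine measure_null_of_locally_null _ fun x hx => ?_
  have hxΩ : x ∈ Ω := by
    by_contra hx'
    exact hx fun h => absurd h hx'
  refine ⟨Metric.ball x (r x) ∩ {a | ¬(a ∈ Ω → g a = c x₁)},
    inter_mem (mem_nhdsWithin_of_mem_nhds (Metric.ball_mem_nhds x (hr x hxΩ)))
      self_mem_nhdsWithin, ?_⟩
  refine measure_mono_null (fun a ha => ?_) (ae_iff.1 (hc x hxΩ))
  intro h'
  exact ha.2 fun _ => (h' ha.1).trans (hcc x hxΩ)

end WeakGradient

/-! ### Rellich's theorem by averaging over small balls. -/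

section WeakCompactness

theorem exists_subseq_tendsto_inner {X : Type*} [NormedAddCommGroup X] [InnerProductSpace ℝ X]
    [CompleteSpace X] [SecondCountableTopology X] {a : ℕ → X} {R : ℝ} (ha : ∀ n, ‖a n‖ ≤ R) :
    ∃ ns : ℕ → ℕ, StrictMono ns ∧ ∃ l : X → ℝ,
      ∀ k, Tendsto (fun n => inner ℝ (a (ns n)) k) atTop (𝓝 (l k)) := by
  obtain ⟨l, -, ns, hns, hl⟩ := WeakDual.isSeqCompact_closedBall ℝ X 0 R
    (x := fun n => StrongDual.toWeakDual (InnerProductSpace.toDual ℝ X (a n)))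
    (fun n => by simpa using ha n)
  refine ⟨ns, hns, fun k => l k, fun k => ?_⟩
  have := ((WeakDual.eval_continuous k).tendsto l).comp hl
  exact this

/-- This replaces a diagonal argument: for each $\varepsilon$ the sequence of ball averages at a
fixed small radius plays the role of $b$. -/
theorem cauchySeq_of_forall_approx {X : Type*} [PseudoMetricSpace X] {a : ℕ → X}
    (h : ∀ ε > 0, ∃ b : ℕ → X, CauchySeq b ∧ ∀ n, dist (a n) (b n) ≤ ε) : CauchySeq a := by
  refine Metric.cauchySeq_iff.2 fun ε hε => ?_
  obtain ⟨b, hb, hab⟩ := h (ε / 4) (by linarith)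
  obtain ⟨N, hN⟩ := Metric.cauchySeq_iff.1 hb (ε / 4) (by linarith)
  refine ⟨N, fun m hm n hn => ?_⟩
  have h1 := dist_triangle4 (a m) (b m) (b n) (a n)
  have h2 := hab m
  have h3 := hab n
  rw [dist_comm] at h3
  linarith [hN m hm n hn]

end WeakCompactness

section Averages

theorem sq_lintegral_le {α : Type*} [MeasurableSpace α] {ν : Measure α} [IsProbabilityMeasure ν]
    {f : α → ℝ≥0∞} (hf : AEMeasurable f ν) : (∫⁻ x, f x ∂ν) ^ 2 ≤ ∫⁻ x, f x ^ 2 ∂ν := by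
  have h := ENNReal.lintegral_mul_le_Lp_mul_Lq ν (p := 2) (q := 2) Real.HolderConjugate.two_two hf
    (aemeasurable_const (b := (1 : ℝ≥0∞)))
  simp only [Pi.mul_apply, mul_one, ENNReal.rpow_ofNat, one_pow, lintegral_const, measure_univ,
    ENNReal.one_rpow] at h
  calc (∫⁻ x, f x ∂ν) ^ 2 ≤ ((∫⁻ x, f x ^ 2 ∂ν) ^ (1 / 2 : ℝ)) ^ 2 := by gcongr
    _ = ∫⁻ x, f x ^ 2 ∂ν := by
      rw [← ENNReal.rpow_natCast, ← ENNReal.rpow_mul]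
      norm_num

variable {d : ℕ} {Ω : Set (EuclideanSpace ℝ (Fin d))} {φ : EuclideanSpace ℝ (Fin d) → ℝ}

/-- The fundamental theorem of calculus along the segment, Jensen's inequality in $t$, Tonelli and
translation invariance. -/
theorem IsTestFunction.lintegral_translate_sub_le (hφ : IsTestFunction Ω φ)
    (h : EuclideanSpace ℝ (Fin d)) :
    ∫⁻ x, ‖φ (x + h) - φ x‖ₑ ^ 2 ≤ ‖h‖ₑ ^ 2 * ∫⁻ x, ‖gradient φ x‖ₑ ^ 2 := by
  let ν : Measure ℝ := volume.restrict (Ioc 0 1)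
  have hν : IsProbabilityMeasure ν := ⟨by simp [ν]⟩
  have hcont : Continuous fun p : EuclideanSpace ℝ (Fin d) × ℝ => gradient φ (p.1 + p.2 • h) :=
    hφ.continuous_gradient.comp (continuous_fst.add (continuous_snd.smul continuous_const))
  have hpt : ∀ x, ‖φ (x + h) - φ x‖ₑ ^ 2 ≤
      ∫⁻ t, ‖h‖ₑ ^ 2 * ‖gradient φ (x + t • h)‖ₑ ^ 2 ∂ν := by
    intro x
    have hc : Continuous fun t : ℝ => inner ℝ (gradient φ (x + t • h)) h :=
      (hcont.comp (continuous_const.prodMk continuous_id)).inner continuous_const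
    have e : φ (x + h) - φ x = ∫ t, inner ℝ (gradient φ (x + t • h)) h ∂ν := by
      have hd : ∀ t ∈ uIcc (0 : ℝ) 1, HasDerivAt (fun t : ℝ => φ (x + t • h))
          (inner ℝ (gradient φ (x + t • h)) h) t := by
        intro t _
        rw [inner_gradient_left]
        have h1 : HasDerivAt (fun t : ℝ => x + t • h) h t := by
          simpa using ((hasDerivAt_id t).smul_const h).const_add x
        exact (hφ.differentiable _).hasFDerivAt.comp_hasDerivAt t h1
      have := intervalIntegral.integral_eq_sub_of_hasDerivAt hd (hc.intervalIntegrable 0 1)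
      rw [intervalIntegral.integral_of_le zero_le_one] at this
      simp only [ν, this, one_smul, zero_smul, add_zero]
    calc ‖φ (x + h) - φ x‖ₑ ^ 2
        ≤ (∫⁻ t, ‖inner ℝ (gradient φ (x + t • h)) h‖ₑ ∂ν) ^ 2 := by
          rw [e]
          gcongr
          exact enorm_integral_le_lintegral_enorm _
      _ ≤ ∫⁻ t, ‖inner ℝ (gradient φ (x + t • h)) h‖ₑ ^ 2 ∂ν :=
          sq_lintegral_le hc.enorm.measurable.aemeasurable
      _ ≤ ∫⁻ t, ‖h‖ₑ ^ 2 * ‖gradient φ (x + t • h)‖ₑ ^ 2 ∂ν := by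
          refine lintegral_mono fun t => ?_
          rw [← mul_pow]
          gcongr
          rw [mul_comm, ← ofReal_norm, ← ofReal_norm, ← ofReal_norm,
            ← ENNReal.ofReal_mul (norm_nonneg _)]
          exact ENNReal.ofReal_le_ofReal (norm_inner_le_norm _ _)
  calc ∫⁻ x, ‖φ (x + h) - φ x‖ₑ ^ 2
      ≤ ∫⁻ x, ∫⁻ t, ‖h‖ₑ ^ 2 * ‖gradient φ (x + t • h)‖ₑ ^ 2 ∂ν := lintegral_mono hpt
    _ = ∫⁻ t, (∫⁻ x, ‖h‖ₑ ^ 2 * ‖gradient φ (x + t • h)‖ₑ ^ 2) ∂ν := by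
        refine lintegral_lintegral_swap ?_
        exact ((hcont.enorm.measurable.pow_const 2).const_mul _).aemeasurable
    _ = ∫⁻ _t, ‖h‖ₑ ^ 2 * (∫⁻ x, ‖gradient φ x‖ₑ ^ 2) ∂ν := by
        refine lintegral_congr fun t => ?_
        rw [lintegral_const_mul']
        · rw [lintegral_add_right_eq_self (fun x => ‖gradient φ x‖ₑ ^ 2) (t • h)]
        · simp
    _ = ‖h‖ₑ ^ 2 * ∫⁻ x, ‖gradient φ x‖ₑ ^ 2 := by simp

/-- The mean of `φ` over the ball of radius `r` about `x`. -/
def ballAverage (r : ℝ) (φ : EuclideanSpace ℝ (Fin d) → ℝ) (x : EuclideanSpace ℝ (Fin d)) : ℝ :=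
  ∫ h, φ (x + h) ∂(ProbabilityTheory.cond volume (Metric.ball 0 r))

theorem isProbabilityMeasure_cond_ball {r : ℝ} (hr : 0 < r) :
    IsProbabilityMeasure (ProbabilityTheory.cond volume
      (Metric.ball (0 : EuclideanSpace ℝ (Fin d)) r)) :=
  ProbabilityTheory.cond_isProbabilityMeasure_of_finite (Metric.measure_ball_pos _ _ hr).ne'
    measure_ball_lt_top.ne

theorem IsTestFunction.stronglyMeasurable_ballAverage (hφ : IsTestFunction Ω φ) {r : ℝ}
    (hr : 0 < r) : StronglyMeasurable (ballAverage r φ) := by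
  have hν := isProbabilityMeasure_cond_ball (d := d) hr
  have hc : Continuous fun p : EuclideanSpace ℝ (Fin d) × EuclideanSpace ℝ (Fin d) =>
      φ (p.1 + p.2) := hφ.continuous.comp (continuous_fst.add continuous_snd)
  exact hc.stronglyMeasurable.integral_prod_right'

/-- The average is over translates by $h$ with $|h|<r$, so Jensen reduces the claim to the
translation estimate. -/
theorem IsTestFunction.lintegral_sub_ballAverage_le (hφ : IsTestFunction Ω φ) {r : ℝ}
    (hr : 0 < r) :
    ∫⁻ x, ‖φ x - ballAverage r φ x‖ₑ ^ 2 ≤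
      ENNReal.ofReal r ^ 2 * ∫⁻ x, ‖gradient φ x‖ₑ ^ 2 := by
  have hν := isProbabilityMeasure_cond_ball (d := d) hr
  have hb : ∀ᵐ h ∂ProbabilityTheory.cond volume (Metric.ball (0 : EuclideanSpace ℝ (Fin d)) r),
      h ∈ Metric.ball (0 : EuclideanSpace ℝ (Fin d)) r :=
    ProbabilityTheory.ae_cond_mem Metric.isOpen_ball.measurableSet
  unfold ballAverage
  set ν := ProbabilityTheory.cond volume (Metric.ball (0 : EuclideanSpace ℝ (Fin d)) r)
  have hc : Continuous fun p : EuclideanSpace ℝ (Fin d) × EuclideanSpace ℝ (Fin d) =>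
      φ (p.1 + p.2) - φ p.1 :=
    (hφ.continuous.comp (continuous_fst.add continuous_snd)).sub (hφ.continuous.comp continuous_fst)
  obtain ⟨M, hM⟩ := hφ.2.1.exists_bound_of_continuous hφ.continuous
  have hpt : ∀ x, ‖φ x - ∫ h, φ (x + h) ∂ν‖ₑ ^ 2 ≤ ∫⁻ h, ‖φ (x + h) - φ x‖ₑ ^ 2 ∂ν := by
    intro x
    have hcx : Continuous fun h => φ (x + h) := hφ.continuous.comp (continuous_const.add continuous_id)
    have hi : Integrable (fun h => φ (x + h)) ν :=
      Integrable.of_bound hcx.aestronglyMeasurable M (Eventually.of_forall fun h => hM _)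
    have e : (∫ h, φ (x + h) ∂ν) - φ x = ∫ h, (φ (x + h) - φ x) ∂ν := by
      rw [integral_sub hi (integrable_const _)]
      simp
    rw [← enorm_neg, neg_sub, e]
    calc _ ≤ (∫⁻ h, ‖φ (x + h) - φ x‖ₑ ∂ν) ^ 2 := by
          gcongr
          exact enorm_integral_le_lintegral_enorm _
      _ ≤ _ := sq_lintegral_le (hcx.sub continuous_const).enorm.measurable.aemeasurable
  calc _ ≤ ∫⁻ x, ∫⁻ h, ‖φ (x + h) - φ x‖ₑ ^ 2 ∂ν := lintegral_mono hpt
    _ = ∫⁻ h, (∫⁻ x, ‖φ (x + h) - φ x‖ₑ ^ 2) ∂ν :=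
        lintegral_lintegral_swap (hc.enorm.measurable.pow_const 2).aemeasurable
    _ ≤ ∫⁻ _h, ENNReal.ofReal r ^ 2 * (∫⁻ x, ‖gradient φ x‖ₑ ^ 2) ∂ν := by
        refine lintegral_mono_ae ?_
        filter_upwards [hb] with h hh
        refine (hφ.lintegral_translate_sub_le h).trans ?_
        gcongr
        rw [← ofReal_norm]
        exact ENNReal.ofReal_le_ofReal (mem_ball_zero_iff.1 hh).le
    _ = _ := by simp

theorem eLpNorm_two_sq {α F : Type*} [MeasurableSpace α] {μ : Measure α} [NormedAddCommGroup F]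
    (u : α → F) : eLpNorm u 2 μ ^ 2 = ∫⁻ x, ‖u x‖ₑ ^ 2 ∂μ := by
  rw [eLpNorm_eq_lintegral_rpow_enorm_toReal (by simp) (by simp), ← ENNReal.rpow_natCast,
    ← ENNReal.rpow_mul]
  simp

theorem IsTestFunction.eLpNorm_sub_ballAverage_le (hφ : IsTestFunction Ω φ) {r : ℝ}
    (hr : 0 < r) :
    eLpNorm (fun x => φ x - ballAverage r φ x) 2 (volume.restrict Ω) ≤
      ENNReal.ofReal r * eLpNorm (gradient φ) 2 (volume.restrict Ω) := by
  have hsupp : Function.support (gradient φ) ⊆ Ω :=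
    (subset_tsupport _).trans (IsTestFunction.tsupport_gradient_subset.trans hφ.2.2)
  rw [eLpNorm_restrict_eq_of_support_subset hsupp]
  refine (eLpNorm_restrict_le _ _ _ _).trans ?_
  refine (ENNReal.pow_le_pow_left_iff two_ne_zero).1 ?_
  rw [mul_pow, eLpNorm_two_sq, eLpNorm_two_sq]
  exact hφ.lintegral_sub_ballAverage_le hr

/-- As a pairing with a fixed $L^2(\Omega)$ function, the average at each point passes to the limit
under weak convergence. -/
theorem IsTestFunction.ballAverage_eq (hφ : IsTestFunction Ω φ) (r : ℝ)
    (x : EuclideanSpace ℝ (Fin d)) :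
    ballAverage r φ x = (volume (Metric.ball (0 : EuclideanSpace ℝ (Fin d)) r))⁻¹.toReal *
      ∫ y in Ω, inner ℝ (φ y) ((Metric.ball x r).indicator (fun _ => (1 : ℝ)) y) := by
  rw [ballAverage, ProbabilityTheory.cond, integral_smul_measure, smul_eq_mul]
  congr 1
  rw [setIntegral_eq_integral_of_forall_compl_eq_zero (s := Ω)]
  · rw [← integral_indicator Metric.isOpen_ball.measurableSet,
      ← integral_add_left_eq_self (fun y => inner ℝ (φ y)
        ((Metric.ball x r).indicator (fun _ => (1 : ℝ)) y)) x]
    refine integral_congr_ae (Eventually.of_forall fun h => ?_)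
    by_cases hh : h ∈ Metric.ball (0 : EuclideanSpace ℝ (Fin d)) r
    · have : x + h ∈ Metric.ball x r := by simpa using hh
      simp [indicator_of_mem hh, indicator_of_mem this]
    · have : x + h ∉ Metric.ball x r := by simpa using hh
      simp [indicator_of_notMem hh, indicator_of_notMem this]
  · intro y hy
    rw [image_eq_zero_of_notMem_tsupport fun h => hy (hφ.2.2 h)]
    simp

end Averages

section Rellich

variable {d : ℕ} {Ω : Set (EuclideanSpace ℝ (Fin d))}

theorem norm_toLp_indicator_le [IsFiniteMeasure (volume.restrict Ω)]
    {s : Set (EuclideanSpace ℝ (Fin d))}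
    (hs : MemLp (s.indicator fun _ => (1 : ℝ)) 2 (volume.restrict Ω)) :
    ‖hs.toLp _‖ ≤ ‖(memLp_const (1 : ℝ) : MemLp _ 2 (volume.restrict Ω)).toLp‖ := by
  refine Lp.norm_le_norm_of_ae_le ?_
  filter_upwards [hs.coeFn_toLp, (memLp_const (1 : ℝ) :
    MemLp _ 2 (volume.restrict Ω)).coeFn_toLp] with x h1 h2
  rw [h1, h2]
  exact norm_indicator_le_norm_self _ _

/-- **Rellich's theorem** for test functions: a sequence bounded in `W_0^{1,2}(Ω)` has a
subsequence that converges in `L²(Ω)`. -/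
theorem exists_subseq_cauchySeq_toLp (hΩ : Bornology.IsBounded Ω)
    {φ : ℕ → EuclideanSpace ℝ (Fin d) → ℝ} (hφ : ∀ n, IsTestFunction Ω (φ n)) {R : ℝ}
    (h1 : ∀ n, ‖((hφ n).memLp 2).toLp (φ n)‖ ≤ R)
    (h2 : ∀ n, ‖((hφ n).memLp_gradient 2).toLp (gradient (φ n))‖ ≤ R) :
    ∃ ns : ℕ → ℕ, StrictMono ns ∧
      CauchySeq fun n => ((hφ (ns n)).memLp 2).toLp (φ (ns n)) := by
  have hfin : IsFiniteMeasure (volume.restrict Ω) :=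
    isFiniteMeasure_restrict.2 hΩ.measure_lt_top.ne
  have : Fact ((2 : ℝ≥0∞) ≠ ⊤) := ⟨by simp⟩
  obtain ⟨ns, hns, l, hl⟩ := exists_subseq_tendsto_inner h1
  refine ⟨ns, hns, cauchySeq_of_forall_approx fun ε hε => ?_⟩
  have hR : 0 ≤ R := (norm_nonneg _).trans (h1 0)
  -- Averaging at radius $r$ costs at most $rR\le\varepsilon$ in $L^2$, uniformly along the
  -- sequence.
  obtain ⟨r, hr, hrε⟩ : ∃ r > 0, r * R ≤ ε := by
    refine ⟨ε / (R + 1), by positivity, ?_⟩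
    rw [div_mul_eq_mul_div, div_le_iff₀ (by linarith)]
    nlinarith
  have hk : ∀ x : EuclideanSpace ℝ (Fin d),
      MemLp ((Metric.ball x r).indicator fun _ => (1 : ℝ)) 2 (volume.restrict Ω) := fun x =>
    (memLp_const 1).indicator Metric.isOpen_ball.measurableSet
  set V := (volume (Metric.ball (0 : EuclideanSpace ℝ (Fin d)) r))⁻¹.toReal
  have hA : ∀ n x, ballAverage r (φ n) x =
      V * inner ℝ (((hφ n).memLp 2).toLp (φ n)) ((hk x).toLp _) := fun n x => by
    rw [inner_toLp, (hφ n).ballAverage_eq]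
  set K := ‖(memLp_const (1 : ℝ) : MemLp _ 2 (volume.restrict Ω)).toLp‖
  have hAb : ∀ n x, ‖ballAverage r (φ n) x‖ ≤ V * (R * K) := by
    intro n x
    rw [hA, norm_mul, Real.norm_of_nonneg (show 0 ≤ V from ENNReal.toReal_nonneg)]
    refine mul_le_mul_of_nonneg_left ((norm_inner_le_norm _ _).trans ?_) ENNReal.toReal_nonneg
    exact mul_le_mul (h1 n) (norm_toLp_indicator_le _) (norm_nonneg _) hR
  have hAm : ∀ n, AEStronglyMeasurable (ballAverage r (φ n)) (volume.restrict Ω) := fun n =>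
    ((hφ n).stronglyMeasurable_ballAverage hr).aestronglyMeasurable
  have hAL : ∀ n, MemLp (ballAverage r (φ n)) 2 (volume.restrict Ω) := fun n =>
    MemLp.of_bound (hAm n) _ (Eventually.of_forall (hAb n))
  have hlim : ∀ x, Tendsto (fun n => ballAverage r (φ (ns n)) x) atTop
      (𝓝 (V * l ((hk x).toLp _))) := fun x => by
    simp_rw [hA]
    exact (hl _).const_mul V
  set a : EuclideanSpace ℝ (Fin d) → ℝ := fun x => V * l ((hk x).toLp _)
  have ham : AEStronglyMeasurable a (volume.restrict Ω) :=
    aestronglyMeasurable_of_tendsto_ae atTop (fun n => hAm (ns n)) (Eventually.of_forall hlim)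
  have hab : ∀ x, ‖a x‖ ≤ V * (R * K) := fun x =>
    le_of_tendsto (hlim x).norm (Eventually.of_forall fun n => hAb _ x)
  have haL : MemLp a 2 (volume.restrict Ω) := MemLp.of_bound ham _ (Eventually.of_forall hab)
  refine ⟨fun n => (hAL (ns n)).toLp _, ?_, fun n => ?_⟩
  -- At fixed $r$ the averages converge pointwise and are uniformly bounded on a set of finite
  -- measure, hence converge in $L^2$.
  · refine Tendsto.cauchySeq (x := haL.toLp a) ((tendsto_toLp_iff _ haL).2 ?_)
    refine tendsto_eLpNorm_zero_of_dominated (b := fun _ => V * (R * K) + V * (R * K))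
      (fun n => (hAm _).sub ham) (memLp_const _) (fun n => Eventually.of_forall fun x => ?_)
      (Eventually.of_forall fun x => ?_)
    · exact (norm_sub_le _ _).trans (add_le_add (hAb _ x) (hab x))
    · simpa [a] using (hlim x).sub_const (a x)
  · rw [dist_eq_norm, ← MemLp.toLp_sub, Lp.norm_toLp]
    refine le_trans (ENNReal.toReal_mono ?_ ((hφ (ns n)).eLpNorm_sub_ballAverage_le hr)) ?_
    · exact ENNReal.mul_ne_top ENNReal.ofReal_ne_top ((hφ _).memLp_gradient 2).2.ne
    · rw [ENNReal.toReal_mul, ENNReal.toReal_ofReal hr.le, ← Lp.norm_toLp _ ((hφ _).memLp_gradient 2)]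
      exact (mul_le_mul_of_nonneg_left (h2 _) hr.le).trans hrε

end Rellich

/-! ### Minimizers of a Rayleigh quotient in Hilbert spaces. -/

section Minimization

variable {X Y : Type*} [NormedAddCommGroup X] [InnerProductSpace ℝ X]
  [NormedAddCommGroup Y] [InnerProductSpace ℝ Y]

/-- Compactness is assumed only for the first component of a bounded sequence. For a minimizing
sequence the second then converges strongly too. -/
theorem exists_rayleigh_minimizer [CompleteSpace X] [CompleteSpace Y] {W : Submodule ℝ (X × Y)} (hW : IsClosed (W : Set (X × Y)))
    (hcomp : ∀ (w : ℕ → X × Y) (R : ℝ), (∀ n, w n ∈ W) → (∀ n, ‖(w n).1‖ ≤ R) →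
      (∀ n, ‖(w n).2‖ ≤ R) → ∃ ns : ℕ → ℕ, StrictMono ns ∧ CauchySeq fun n => (w (ns n)).1)
    (hne : ∃ w ∈ W, w.1 ≠ 0) :
    ∃ w ∈ W, ‖w.1‖ = 1 ∧ ∀ v ∈ W, ‖w.2‖ ^ 2 * ‖v.1‖ ^ 2 ≤ ‖v.2‖ ^ 2 := by
  let S : Set ℝ := (fun w : X × Y => ‖w.2‖ ^ 2) '' {w | w ∈ W ∧ ‖w.1‖ = 1}
  have hbdd : BddBelow S := ⟨0, by rintro _ ⟨w, -, rfl⟩; positivity⟩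
  have hS : S.Nonempty := by
    obtain ⟨w, hw, hw0⟩ := hne
    refine ⟨_, ‖w.1‖⁻¹ • w, ⟨W.smul_mem _ hw, ?_⟩, rfl⟩
    rw [Prod.smul_fst, norm_smul, norm_inv, norm_norm, inv_mul_cancel₀ (norm_ne_zero_iff.2 hw0)]
  set ν := sInf S
  have hν0 : 0 ≤ ν := le_csInf hS (by rintro _ ⟨w, -, rfl⟩; positivity)
  have hν : ∀ v ∈ W, ν * ‖v.1‖ ^ 2 ≤ ‖v.2‖ ^ 2 := by
    intro v hv
    rcases eq_or_ne v.1 0 with h0 | h0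
    · simp [h0]
    have hpos : 0 < ‖v.1‖ := norm_pos_iff.2 h0
    have : ν ≤ ‖(‖v.1‖⁻¹ • v).2‖ ^ 2 := by
      refine csInf_le hbdd ⟨_, ⟨W.smul_mem _ hv, ?_⟩, rfl⟩
      rw [Prod.smul_fst, norm_smul, norm_inv, norm_norm, inv_mul_cancel₀ hpos.ne']
    rw [Prod.smul_snd, norm_smul, norm_inv, norm_norm, mul_pow, inv_pow,
      inv_mul_eq_div, le_div_iff₀ (by positivity)] at this
    exact this
  obtain ⟨s, -, hs, hsS⟩ := exists_seq_tendsto_sInf hS hbdd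
  choose w hw hws using hsS
  have hlim : Tendsto (fun n => ‖(w n).2‖ ^ 2) atTop (𝓝 ν) := hs.congr fun n => (hws n).symm
  obtain ⟨C, hC⟩ := hlim.bddAbove_range
  have hC' : ∀ n, ‖(w n).2‖ ^ 2 ≤ C := fun n => hC ⟨n, rfl⟩
  have hC0 : 0 ≤ C := (sq_nonneg _).trans (hC' 0)
  obtain ⟨ns, hns, hcau⟩ := hcomp w (C + 1) (fun n => (hw n).1)
    (fun n => by rw [(hw n).2]; linarith)
    (fun n => by nlinarith [hC' n, sq_nonneg (‖(w n).2‖ - 1)])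
  replace hlim := hlim.comp hns.tendsto_atTop
  -- The parallelogram law in both components: the sum of two near-minimizers has quotient at least
  -- $\nu$, which bounds the difference of their second components by energy excess and distance of
  -- the first components.
  have hcau2 : CauchySeq fun n => (w (ns n)).2 := by
    have h1 := cauchySeq_iff_tendsto_dist_atTop_0.1 hcau
    have h2 : Tendsto (fun n : ℕ × ℕ => 2 * (‖(w (ns n.1)).2‖ ^ 2 - ν) +
        2 * (‖(w (ns n.2)).2‖ ^ 2 - ν) + ν * dist (w (ns n.1)).1 (w (ns n.2)).1 ^ 2) atTop (𝓝 0) := by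
      rw [← prod_atTop_atTop_eq]
      have ha := ((hlim.comp (tendsto_fst (f := atTop) (g := (atTop : Filter ℕ)))).sub_const ν).const_mul 2
      have hb := ((hlim.comp (tendsto_snd (f := (atTop : Filter ℕ)) (g := atTop))).sub_const ν).const_mul 2
      rw [← prod_atTop_atTop_eq] at h1
      have := (ha.add hb).add ((h1.pow 2).const_mul ν)
      simpa [Function.comp_def] using this
    have h3 : Tendsto (fun n : ℕ × ℕ => dist (w (ns n.1)).2 (w (ns n.2)).2 ^ 2) atTop (𝓝 0) := by
      refine squeeze_zero (fun _ => sq_nonneg _) (fun n => ?_) h2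
      have e1 := parallelogram_law_with_norm ℝ (w (ns n.1)).2 (w (ns n.2)).2
      have e2 := parallelogram_law_with_norm ℝ (w (ns n.1)).1 (w (ns n.2)).1
      rw [(hw (ns n.1)).2, (hw (ns n.2)).2] at e2
      have e3 := hν _ (W.add_mem (hw (ns n.1)).1 (hw (ns n.2)).1)
      rw [Prod.fst_add, Prod.snd_add] at e3
      rw [dist_eq_norm, dist_eq_norm]
      have e4 : ‖(w (ns n.1)).1 + (w (ns n.2)).1‖ ^ 2 =
        4 - ‖(w (ns n.1)).1 - (w (ns n.2)).1‖ ^ 2 := by linarith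
      rw [e4] at e3
      nlinarith
    refine cauchySeq_iff_tendsto_dist_atTop_0.2 ?_
    have := (Real.continuous_sqrt.tendsto 0).comp h3
    simpa [Function.comp_def, Real.sqrt_sq dist_nonneg] using this
  obtain ⟨x, hx⟩ := cauchySeq_tendsto_of_complete hcau
  obtain ⟨y, hy⟩ := cauchySeq_tendsto_of_complete hcau2
  have hy2 : ‖y‖ ^ 2 = ν := tendsto_nhds_unique (hy.norm.pow 2) hlim
  refine ⟨(x, y), hW.mem_of_tendsto (hx.prodMk_nhds hy) (Eventually.of_forall fun n =>
    (hw (ns n)).1), ?_, fun v hv => ?_⟩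
  · exact tendsto_nhds_unique hx.norm (tendsto_const_nhds.congr fun n => ((hw (ns n)).2).symm)
  · rw [hy2]
    exact hν v hv

/-- Perturbing by $tv$ gives a nonnegative quadratic in $t$ without constant term; its discriminant
forces the linear coefficient to vanish. -/
theorem inner_eq_of_rayleigh_minimizer {W : Submodule ℝ (X × Y)} {w : X × Y} (hw : w ∈ W)
    (hw1 : ‖w.1‖ = 1) (hmin : ∀ v ∈ W, ‖w.2‖ ^ 2 * ‖v.1‖ ^ 2 ≤ ‖v.2‖ ^ 2) {v : X × Y}
    (hv : v ∈ W) : inner ℝ w.2 v.2 = ‖w.2‖ ^ 2 * inner ℝ w.1 v.1 := by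
  have key : ∀ t : ℝ, 0 ≤ (‖v.2‖ ^ 2 - ‖w.2‖ ^ 2 * ‖v.1‖ ^ 2) * (t * t) +
      (2 * (inner ℝ w.2 v.2 - ‖w.2‖ ^ 2 * inner ℝ w.1 v.1)) * t + 0 := by
    intro t
    have h := hmin _ (W.add_mem hw (W.smul_mem t hv))
    rw [Prod.fst_add, Prod.snd_add, Prod.smul_fst, Prod.smul_snd, norm_add_sq_real,
      norm_add_sq_real, norm_smul, norm_smul, mul_pow, mul_pow, real_inner_smul_right,
      real_inner_smul_right, hw1, Real.norm_eq_abs, sq_abs] at h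
    nlinarith
  have h := discrim_le_zero key
  rw [discrim] at h
  nlinarith [sq_nonneg (inner ℝ w.2 v.2 - ‖w.2‖ ^ 2 * inner ℝ w.1 v.1)]

end Minimization

/-! ### Compactness for the energy space. -/

section EnergyCompactness

variable {d : ℕ} {Ω : Set (EuclideanSpace ℝ (Fin d))}

theorem exists_subseq_cauchySeq_energySpace (hΩ : Bornology.IsBounded Ω)
    (w : ℕ → Lp ℝ 2 (volume.restrict Ω) × Lp (EuclideanSpace ℝ (Fin d)) 2 (volume.restrict Ω))
    (R : ℝ) (hw : ∀ n, w n ∈ energySpace Ω) (h1 : ∀ n, ‖(w n).1‖ ≤ R) (h2 : ∀ n, ‖(w n).2‖ ≤ R) :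
    ∃ ns : ℕ → ℕ, StrictMono ns ∧ CauchySeq fun n => (w (ns n)).1 := by
  have happ : ∀ n : ℕ, ∃ p ∈ testPairs Ω, dist (w n) p < 1 / ((n : ℝ) + 1) := fun n =>
    Metric.mem_closure_iff.1 (hw n) _ (by positivity)
  choose p hp hdist using happ
  choose φ hφ e1 e2 using hp
  have f1 : ∀ n, ((hφ n).memLp 2).toLp (φ n) = (p n).1 := fun n =>
    Lp.ext (((hφ n).memLp 2).coeFn_toLp.trans (e1 n).symm)
  have f2 : ∀ n, ((hφ n).memLp_gradient 2).toLp (gradient (φ n)) = (p n).2 := fun n =>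
    Lp.ext (((hφ n).memLp_gradient 2).coeFn_toLp.trans (e2 n).symm)
  have hle : ∀ n, dist (w n) (p n) ≤ 1 := fun n => (hdist n).le.trans (by
    rw [div_le_one (by positivity)]
    linarith [(Nat.cast_nonneg n : (0 : ℝ) ≤ n)])
  obtain ⟨ns, hns, hc⟩ := exists_subseq_cauchySeq_toLp hΩ hφ (R := R + 1)
    (fun n => by
      rw [f1]
      have := norm_le_norm_add_norm_sub' (p n).1 (w n).1
      have h3 : ‖(p n).1 - (w n).1‖ ≤ dist (w n) (p n) := by
        rw [dist_comm, dist_eq_norm]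
        exact norm_fst_le (p n - w n)
      linarith [h1 n, hle n])
    (fun n => by
      rw [f2]
      have := norm_le_norm_add_norm_sub' (p n).2 (w n).2
      have h3 : ‖(p n).2 - (w n).2‖ ≤ dist (w n) (p n) := by
        rw [dist_comm, dist_eq_norm]
        exact norm_snd_le (p n - w n)
      linarith [h2 n, hle n])
  refine ⟨ns, hns, ?_⟩
  obtain ⟨x, hx⟩ := cauchySeq_tendsto_of_complete hc
  simp_rw [f1] at hx
  refine Tendsto.cauchySeq (x := x) ?_
  rw [tendsto_iff_dist_tendsto_zero] at hx ⊢
  have h0 : Tendsto (fun n => 1 / ((ns n : ℝ) + 1)) atTop (𝓝 0) :=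
    (tendsto_one_div_add_atTop_nhds_zero_nat (𝕜 := ℝ)).comp hns.tendsto_atTop
  refine squeeze_zero (fun _ => dist_nonneg) (fun n => ?_) (by have := h0.add hx; rwa [add_zero] at this)
  refine (dist_triangle _ (p (ns n)).1 _).trans (add_le_add ?_ le_rfl)
  exact (le_max_left _ _).trans (hdist (ns n)).le

end EnergyCompactness

/-! ### The second eigenvalue and the strict spectral gap. -/

section SecondEigenvalue

variable {d : ℕ} {Ω : Set (EuclideanSpace ℝ (Fin d))} {Φ u : EuclideanSpace ℝ (Fin d) → ℝ}
  {U : EuclideanSpace ℝ (Fin d) → EuclideanSpace ℝ (Fin d)}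

theorem inner_toLp_eq_of_weak_eigen {m : ℝ} (hU : MemW012 Ω u U)
    (heq : ∀ v V, MemW012 Ω v V → ∫ x in Ω, inner ℝ (U x) (V x) = m * ∫ x in Ω, u x * v x)
    {p : Lp ℝ 2 (volume.restrict Ω) × Lp (EuclideanSpace ℝ (Fin d)) 2 (volume.restrict Ω)}
    (hp : p ∈ energySpace Ω) :
    inner ℝ (hU.2.1.toLp U) p.2 = m * inner ℝ (hU.1.toLp u) p.1 := by
  have h := heq _ _ (memW012_coeFn_iff.2 hp)
  have h1 := inner_toLp hU.2.1 (Lp.memLp p.2)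
  have h2 := inner_toLp hU.1 (Lp.memLp p.1)
  rw [Lp.toLp_coeFn] at h1 h2
  rw [h1, h2, h]
  simp [mul_comm]

theorem MemW012.toLp_mem (hU : MemW012 Ω u U) :
    (hU.1.toLp u, hU.2.1.toLp U) ∈ energySpace Ω := (memW012_iff.1 hU).2.2

theorem toLp_ne_zero_iff (hu : MemLp u 2 (volume.restrict Ω)) :
    hu.toLp u ≠ 0 ↔ ¬u =ᵐ[volume.restrict Ω] 0 := by
  rw [Ne, Lp.eq_zero_iff_ae_eq_zero]
  exact not_congr ⟨fun h => hu.coeFn_toLp.symm.trans h, fun h => hu.coeFn_toLp.trans h⟩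

theorem exists_isTestFunction_apply_eq_one {x : EuclideanSpace ℝ (Fin d)}
    {s : Set (EuclideanSpace ℝ (Fin d))} (hs : s ∈ 𝓝 x) : ∃ φ, IsTestFunction s φ ∧ φ x = 1 := by
  obtain ⟨φ, h1, h2, h3, -, h4⟩ := exists_contDiff_tsupport_subset (n := ⊤) hs
  exact ⟨φ, ⟨h3, h2, h1⟩, h4⟩

theorem IsTestFunction.mono {s : Set (EuclideanSpace ℝ (Fin d))} (hu : IsTestFunction s u)
    (hs : s ⊆ Ω) : IsTestFunction Ω u :=
  ⟨hu.1, hu.2.1, hu.2.2.trans hs⟩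

theorem IsTestFunction.toLp_ne_zero (hΩ : IsOpen Ω) (hu : IsTestFunction Ω u)
    {x : EuclideanSpace ℝ (Fin d)} (hx : u x ≠ 0) : (hu.memLp 2).toLp u ≠ 0 := by
  rw [toLp_ne_zero_iff]
  intro h
  have hxΩ : x ∈ Ω := hu.2.2 (subset_tsupport _ hx)
  exact hx (Measure.eqOn_open_of_ae_eq h hΩ hu.continuous.continuousOn continuousOn_const hxΩ)

/-- The pairs `(f, ∇f)` in the energy space with `f` orthogonal to `e`. -/
def energyOrthogonal (Ω : Set (EuclideanSpace ℝ (Fin d))) (e : Lp ℝ 2 (volume.restrict Ω)) :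
    Submodule ℝ (Lp ℝ 2 (volume.restrict Ω) ×
      Lp (EuclideanSpace ℝ (Fin d)) 2 (volume.restrict Ω)) :=
  energySpace Ω ⊓ LinearMap.ker ((innerSL ℝ e).comp (ContinuousLinearMap.fst ℝ
    (Lp ℝ 2 (volume.restrict Ω)) (Lp (EuclideanSpace ℝ (Fin d)) 2 (volume.restrict Ω)))).toLinearMap

variable {e : Lp ℝ 2 (volume.restrict Ω)}

theorem mem_energyOrthogonal
    {p : Lp ℝ 2 (volume.restrict Ω) × Lp (EuclideanSpace ℝ (Fin d)) 2 (volume.restrict Ω)} :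
    p ∈ energyOrthogonal Ω e ↔ p ∈ energySpace Ω ∧ inner ℝ e p.1 = 0 := by
  simp [energyOrthogonal]

theorem isClosed_energyOrthogonal : IsClosed (energyOrthogonal Ω e :
    Set (Lp ℝ 2 (volume.restrict Ω) × Lp (EuclideanSpace ℝ (Fin d)) 2 (volume.restrict Ω))) :=
  isClosed_energySpace.inter (ContinuousLinearMap.isClosed_ker _)

theorem exists_energyOrthogonal_ne_zero (hd : 1 ≤ d) (hΩ : IsOpen Ω) (hne : Ω.Nonempty) :
    ∃ p ∈ energyOrthogonal Ω e, p.1 ≠ 0 := by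
  have : Nonempty (Fin d) := ⟨⟨0, hd⟩⟩
  obtain ⟨x, hx⟩ := hne
  have hnt : Nontrivial (EuclideanSpace ℝ (Fin d)) := inferInstance
  have hnb : (𝓝[≠] x).NeBot := Module.punctured_nhds_neBot ℝ _ x
  have hev : ∀ᶠ y in 𝓝[≠] x, y ∈ Ω ∧ y ∈ ({x}ᶜ : Set _) :=
    inter_mem (mem_nhdsWithin_of_mem_nhds (hΩ.mem_nhds hx)) self_mem_nhdsWithin
  obtain ⟨y, hy, hyx⟩ := hev.exists
  obtain ⟨φ, hφ', hφx⟩ := exists_isTestFunction_apply_eq_one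
    (inter_mem (hΩ.mem_nhds hx) (isOpen_ne.mem_nhds (Ne.symm hyx)))
  obtain ⟨ψ, hψ, hψy⟩ := exists_isTestFunction_apply_eq_one (hΩ.mem_nhds hy)
  have hφ := hφ'.mono inter_subset_left
  have hφy : φ y = 0 := image_eq_zero_of_notMem_tsupport fun h => (hφ'.2.2 h).2 rfl
  set a := inner ℝ e ((hφ.memLp 2).toLp φ)
  set b := inner ℝ e ((hψ.memLp 2).toLp ψ)
  by_cases ha : a = 0
  · exact ⟨_, mem_energyOrthogonal.2 ⟨hφ.memW012.toLp_mem, ha⟩,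
      hφ.toLp_ne_zero hΩ (x := x) (by simp [hφx])⟩
  -- The combination $b\varphi-a\psi$ is orthogonal to $e$, and at $y$ it equals $-a\ne0$, because
  -- $\varphi$ is supported away from $y$.
  · have hχ := (hφ.const_mul b).sub (hψ.const_mul a)
    have hp := (energySpace Ω).sub_mem ((energySpace Ω).smul_mem b hφ.memW012.toLp_mem)
      ((energySpace Ω).smul_mem a hψ.memW012.toLp_mem)
    refine ⟨_, mem_energyOrthogonal.2 ⟨hp, ?_⟩, ?_⟩
    · simp only [Prod.fst_sub, Prod.smul_fst, inner_sub_right, real_inner_smul_right]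
      change b * a - a * b = 0
      ring
    · exact hχ.toLp_ne_zero hΩ (x := y) (by simp [hφy, hψy, ha])

theorem IsGroundState.dirichletEigenvalue_one_nonneg (hΦ : IsGroundState Ω Φ) :
    0 ≤ dirichletEigenvalue Ω 1 := by
  obtain ⟨-, U, hU, heq⟩ := hΦ.eigenfunction
  have h := heq _ _ hU
  have e1 : ∫ x in Ω, Φ x * Φ x = 1 := by
    rw [← hΦ.norm_eq_one]
    simp_rw [sq]
  rw [e1, mul_one] at h
  rw [← h]
  exact integral_nonneg fun x => real_inner_self_nonneg

/-- If the Rayleigh quotient of `f` is the first eigenvalue, then `f` is a multiple of the ground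
state. -/
theorem IsGroundState.ae_eq_const_mul (hΦ : IsGroundState Ω Φ) (hΩ : IsOpen Ω)
    (hΩc : IsPreconnected Ω) {f : EuclideanSpace ℝ (Fin d) → ℝ}
    {F : EuclideanSpace ℝ (Fin d) → EuclideanSpace ℝ (Fin d)} (hf : MemW012 Ω f F)
    (h : ∫ x in Ω, ‖F x‖ ^ 2 = dirichletEigenvalue Ω 1 * ∫ x in Ω, f x ^ 2) :
    ∃ c, ∀ᵐ x ∂volume.restrict Ω, f x = c * Φ x := by
  obtain ⟨-, U, hU, heq⟩ := hΦ.eigenfunction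
  have hw := hΦ.continuousOn.mono subset_closure
  obtain ⟨hR, hR2⟩ := hf.sub_div_smul hw hΦ.pos hΩ.measurableSet hU
    hΦ.dirichletEigenvalue_one_nonneg heq
  have hg := hf.hasWeakGradient_div hw hΦ.pos hΩ hU hR
  rw [h, sub_self, integral_eq_zero_iff_of_nonneg (fun _ => sq_nonneg _)
    (integrable_norm_sq hR)] at hR2
  obtain ⟨c, hc⟩ := ae_const_of_weakGradient_eq_zero hΩ hΩc hg.1 fun φ hφ v => by
    rw [hg.2.2 φ hφ v, neg_eq_zero]
    refine integral_eq_zero_of_ae ?_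
    filter_upwards [hR2] with x hx
    have : F x - (f x / Φ x) • U x = 0 := by simpa using hx
    simp [this]
  refine ⟨c, ?_⟩
  filter_upwards [hc, ae_restrict_mem hΩ.measurableSet] with x hx hxΩ
  rw [← hx, div_mul_cancel₀ _ (hΦ.pos x hxΩ).ne']

theorem integral_sq_eq_norm_sq {f : EuclideanSpace ℝ (Fin d) → ℝ}
    (hf : MemLp f 2 (volume.restrict Ω)) : ∫ x in Ω, f x ^ 2 = ‖hf.toLp f‖ ^ 2 := by
  rw [norm_toLp_sq]
  simp

theorem integral_mul_eq_inner {f g : EuclideanSpace ℝ (Fin d) → ℝ}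
    (hf : MemLp f 2 (volume.restrict Ω)) (hg : MemLp g 2 (volume.restrict Ω)) :
    ∫ x in Ω, f x * g x = inner ℝ (hf.toLp f) (hg.toLp g) := by
  rw [inner_toLp]
  simp [mul_comm]

/-- Two eigenfunctions, orthonormal in `L²(Ω)`, span a plane that meets every hyperplane. -/
theorem le_of_orthonormal_eigenfunctions {ν t : ℝ}
    (hν : ∀ v ∈ energyOrthogonal Ω e, ν * ‖v.1‖ ^ 2 ≤ ‖v.2‖ ^ 2)
    {μ : Fin 2 → ℝ} {u : Fin 2 → EuclideanSpace ℝ (Fin d) → ℝ}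
    (hu : ∀ i, IsDirichletEigenfunction Ω (μ i) (u i))
    (horth : ∀ i j, ∫ x in Ω, u i x * u j x = if i = j then 1 else 0) (ht : ∀ i, μ i ≤ t) :
    ν ≤ t := by
  choose U hU heq using fun i => (hu i).2
  set p := fun i => ((hU i).1.toLp (u i), (hU i).2.1.toLp (U i))
  have hp : ∀ i, p i ∈ energySpace Ω := fun i => (hU i).toLp_mem
  have h1 : ∀ i j, inner ℝ (p i).1 (p j).1 = if i = j then (1 : ℝ) else 0 := fun i j => by
    rw [← horth i j, integral_mul_eq_inner (hU i).1 (hU j).1]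
  have h2 : ∀ i j, inner ℝ (p i).2 (p j).2 = μ i * if i = j then (1 : ℝ) else 0 := fun i j => by
    rw [← h1 i j]
    exact inner_toLp_eq_of_weak_eigen (hU i) (heq i) (hp j)
  obtain ⟨α, β, hαβ, h0⟩ : ∃ α β : ℝ, 0 < α ^ 2 + β ^ 2 ∧
      α * inner ℝ e (p 0).1 + β * inner ℝ e (p 1).1 = 0 := by
    by_cases hz : inner ℝ e (p 0).1 = 0
    · exact ⟨1, 0, by norm_num, by rw [hz]; ring⟩
    · exact ⟨inner ℝ e (p 1).1, -inner ℝ e (p 0).1,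
        add_pos_of_nonneg_of_pos (sq_nonneg _) (sq_pos_iff.2 (neg_ne_zero.2 hz)), by ring⟩
  have hv : α • p 0 + β • p 1 ∈ energyOrthogonal Ω e := by
    refine mem_energyOrthogonal.2 ⟨(energySpace Ω).add_mem ((energySpace Ω).smul_mem _ (hp 0))
      ((energySpace Ω).smul_mem _ (hp 1)), ?_⟩
    rw [Prod.fst_add, Prod.smul_fst, Prod.smul_fst, inner_add_right, real_inner_smul_right,
      real_inner_smul_right, h0]
  have h := hν _ hv
  rw [Prod.fst_add, Prod.snd_add, Prod.smul_fst, Prod.smul_fst, Prod.smul_snd, Prod.smul_snd,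
    ← real_inner_self_eq_norm_sq, ← real_inner_self_eq_norm_sq] at h
  simp only [inner_add_left, inner_add_right, real_inner_smul_left, real_inner_smul_right, h1,
    h2] at h
  simp at h
  have a0 := mul_le_mul_of_nonneg_left (ht 0) (sq_nonneg α)
  have a1 := mul_le_mul_of_nonneg_left (ht 1) (sq_nonneg β)
  have : ν * (α ^ 2 + β ^ 2) ≤ t * (α ^ 2 + β ^ 2) := by nlinarith
  exact le_of_mul_le_mul_right this hαβ

/-- Minimality only gives the equation against $\Phi^\perp$. It extends to all test elements since
the $\Phi$ component contributes nothing: $w\perp\Phi$, and the equation for $\Phi$ gives $\nabla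
w\perp\nabla\Phi$. -/
theorem IsGroundState.inner_eq_of_minimizer (hΦ : IsGroundState Ω Φ)
    (hU : MemW012 Ω Φ U)
    (heq : ∀ v V, MemW012 Ω v V → ∫ x in Ω, inner ℝ (U x) (V x) =
      dirichletEigenvalue Ω 1 * ∫ x in Ω, Φ x * v x)
    {w : Lp ℝ 2 (volume.restrict Ω) × Lp (EuclideanSpace ℝ (Fin d)) 2 (volume.restrict Ω)}
    (hw : w ∈ energyOrthogonal Ω (hU.1.toLp Φ)) (hw1 : ‖w.1‖ = 1)
    (hmin : ∀ v ∈ energyOrthogonal Ω (hU.1.toLp Φ), ‖w.2‖ ^ 2 * ‖v.1‖ ^ 2 ≤ ‖v.2‖ ^ 2)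
    {v : Lp ℝ 2 (volume.restrict Ω) × Lp (EuclideanSpace ℝ (Fin d)) 2 (volume.restrict Ω)}
    (hv : v ∈ energySpace Ω) : inner ℝ w.2 v.2 = ‖w.2‖ ^ 2 * inner ℝ w.1 v.1 := by
  obtain ⟨hwE, hwe⟩ := mem_energyOrthogonal.1 hw
  have he : ‖hU.1.toLp Φ‖ ^ 2 = 1 := by
    rw [← integral_sq_eq_norm_sq, hΦ.norm_eq_one]
  have hv' : v - (inner ℝ (hU.1.toLp Φ) v.1 : ℝ) • (hU.1.toLp Φ, hU.2.1.toLp U) ∈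
      energyOrthogonal Ω (hU.1.toLp Φ) := by
    refine mem_energyOrthogonal.2 ⟨(energySpace Ω).sub_mem hv
      ((energySpace Ω).smul_mem _ hU.toLp_mem), ?_⟩
    rw [Prod.fst_sub, Prod.smul_fst, inner_sub_right, real_inner_smul_right,
      real_inner_self_eq_norm_sq, he, mul_one, sub_self]
  have h1 := inner_eq_of_rayleigh_minimizer hw hw1 hmin hv'
  have h2 := inner_toLp_eq_of_weak_eigen hU heq hwE
  rw [hwe, mul_zero, real_inner_comm] at h2
  rw [real_inner_comm] at hwe
  rw [Prod.fst_sub, Prod.snd_sub, Prod.smul_fst, Prod.smul_snd, inner_sub_right, inner_sub_right,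
    real_inner_smul_right, real_inner_smul_right, h2, hwe] at h1
  simpa using h1

theorem IsGroundState.exists_minimizer (hΦ : IsGroundState Ω Φ) (hd : 1 ≤ d)
    (hΩ : IsOpen Ω) (hne : Ω.Nonempty) (hΩb : Bornology.IsBounded Ω) (hΦ2 : MemLp Φ 2
      (volume.restrict Ω)) :
    ∃ f F, MemW012 Ω f F ∧ ∫ x in Ω, f x * Φ x = 0 ∧ ∫ x in Ω, f x ^ 2 = 1 ∧
      (∀ v ∈ energyOrthogonal Ω (hΦ2.toLp Φ),
        (∫ x in Ω, ‖F x‖ ^ 2) * ‖v.1‖ ^ 2 ≤ ‖v.2‖ ^ 2) ∧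
      IsDirichletEigenfunction Ω (∫ x in Ω, ‖F x‖ ^ 2) f := by
  obtain ⟨-, U, hU, heq⟩ := hΦ.eigenfunction
  obtain ⟨w, hw, hw1, hmin⟩ := exists_rayleigh_minimizer
    (isClosed_energyOrthogonal (e := hU.1.toLp Φ))
    (fun w R hw => exists_subseq_cauchySeq_energySpace hΩb w R
      fun n => (mem_energyOrthogonal.1 (hw n)).1)
    (exists_energyOrthogonal_ne_zero hd hΩ hne)
  obtain ⟨hwE, hwe⟩ := mem_energyOrthogonal.1 hw
  have hwM : MemW012 Ω w.1 w.2 := memW012_coeFn_iff.2 hwE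
  have hwt1 : hwM.1.toLp w.1 = w.1 := Lp.toLp_coeFn _ _
  have hwt2 : hwM.2.1.toLp w.2 = w.2 := Lp.toLp_coeFn _ _
  have hwgrad : ∫ x in Ω, ‖w.2 x‖ ^ 2 = ‖w.2‖ ^ 2 := by
    rw [← norm_toLp_sq hwM.2.1, hwt2]
  refine ⟨w.1, w.2, hwM, ?_, ?_, ?_, ?_, w.2, hwM, fun v V hV => ?_⟩
  · rw [integral_mul_eq_inner hwM.1 hU.1, hwt1, real_inner_comm, hwe]
  · rw [integral_sq_eq_norm_sq hwM.1, hwt1, hw1, one_pow]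
  · rw [hwgrad]
    exact hmin
  · rw [← toLp_ne_zero_iff hwM.1, hwt1]
    intro h
    rw [h, norm_zero] at hw1
    exact zero_ne_one hw1
  · have h1 := hΦ.inner_eq_of_minimizer hU heq hw hw1 hmin hV.toLp_mem
    rw [← inner_toLp hwM.2.1 hV.2.1, integral_mul_eq_inner hwM.1 hV.1, hwt1, hwt2, h1, hwgrad]

/-- The second eigenvalue is attained, is the minimum of the Rayleigh quotient on the orthogonal
complement of the ground state, and exceeds the first one. -/
theorem IsGroundState.exists_second_eigenfunction (hΦ : IsGroundState Ω Φ) (hd : 1 ≤ d)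
    (hΩ : IsOpen Ω) (hΩc : IsConnected Ω) (hΩb : Bornology.IsBounded Ω) :
    dirichletEigenvalue Ω 1 < dirichletEigenvalue Ω 2 ∧
    (∀ f F, MemW012 Ω f F → ∫ x in Ω, f x * Φ x = 0 →
      dirichletEigenvalue Ω 2 * ∫ x in Ω, f x ^ 2 ≤ ∫ x in Ω, ‖F x‖ ^ 2) ∧
    ∃ f F, MemW012 Ω f F ∧ ∫ x in Ω, f x * Φ x = 0 ∧ ∫ x in Ω, f x ^ 2 = 1 ∧
      ∫ x in Ω, ‖F x‖ ^ 2 = dirichletEigenvalue Ω 2 := by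
  obtain ⟨-, U, hU, heq⟩ := hΦ.eigenfunction
  obtain ⟨w, W, hw, hwΦ, hwsq, hmin, hwEig⟩ := hΦ.exists_minimizer hd hΩ hΩc.nonempty hΩb hU.1
  obtain ⟨ν, hν⟩ : ∃ ν, ∫ x in Ω, ‖W x‖ ^ 2 = ν := ⟨_, rfl⟩
  rw [hν] at hmin hwEig
  -- By the ground state representation $\nu-\lambda_1$ is the integral of a square.
  have hle : dirichletEigenvalue Ω 1 ≤ ν := by
    have h := (hw.sub_div_smul (hΦ.continuousOn.mono subset_closure) hΦ.pos hΩ.measurableSet hU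
      hΦ.dirichletEigenvalue_one_nonneg heq).2
    rw [hwsq, hν, mul_one] at h
    have h0 : 0 ≤ ∫ x in Ω, ‖W x - (w x / Φ x) • U x‖ ^ 2 :=
      integral_nonneg fun x => sq_nonneg _
    linarith
  have hlt : dirichletEigenvalue Ω 1 < ν := by
    refine lt_of_le_of_ne hle fun h => ?_
    obtain ⟨c, hc⟩ := hΦ.ae_eq_const_mul hΩ hΩc.isPreconnected hw (by
      rw [hwsq, hν, mul_one, h])
    have h1 : ∫ x in Ω, w x * Φ x = c := by
      calc _ = ∫ x in Ω, c * Φ x ^ 2 := by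
            refine integral_congr_ae ?_
            filter_upwards [hc] with x hx
            rw [hx]
            ring
        _ = c := by rw [integral_const_mul, hΦ.norm_eq_one, mul_one]
    rw [hwΦ] at h1
    refine hwEig.1 ?_
    filter_upwards [hc] with x hx
    rw [hx, ← h1, zero_mul, Pi.zero_apply]
  have hν2 : dirichletEigenvalue Ω 2 = ν := by
    -- The pair $\Phi,w$ shows that $\nu$ is admissible; any other admissible pair spans a plane
    -- meeting $\Phi^\perp$, where the quotient is at least $\nu$.
    refine IsLeast.csInf_eq ⟨⟨![dirichletEigenvalue Ω 1, ν], ![Φ, w], ?_, ?_, ?_⟩, ?_⟩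
    · rw [Fin.forall_fin_two]
      exact ⟨hΦ.eigenfunction, hwEig⟩
    · simp only [Fin.forall_fin_two, Matrix.cons_val_zero, Matrix.cons_val_one, ← sq,
        hΦ.norm_eq_one, hwsq, hwΦ, mul_comm (Φ _)]
      simp
    · rw [Fin.forall_fin_two]
      exact ⟨hle, le_rfl⟩
    · rintro t ⟨μ, u, hu, horth, ht⟩
      exact le_of_orthonormal_eigenfunctions hmin hu horth ht
  rw [hν2]
  refine ⟨hlt, fun f F hf hfΦ => ?_, w, W, hw, hwΦ, hwsq, hν⟩
  rw [integral_sq_eq_norm_sq hf.1, ← norm_toLp_sq hf.2.1]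
  refine hmin (hf.1.toLp f, hf.2.1.toLp F) (mem_energyOrthogonal.2 ⟨hf.toLp_mem, ?_⟩)
  rw [real_inner_comm, ← integral_mul_eq_inner hf.1 hU.1, hfΦ]

end SecondEigenvalue

/-! ### Weighted Poincaré inequalities. -/

section WeightedInequalities

variable {d : ℕ} {Ω : Set (EuclideanSpace ℝ (Fin d))} {Φ f g w W : EuclideanSpace ℝ (Fin d) → ℝ}
  {F U : EuclideanSpace ℝ (Fin d) → EuclideanSpace ℝ (Fin d)}

theorem IsGroundState.memLp (hΦ : IsGroundState Ω Φ) : MemLp Φ 2 (volume.restrict Ω) := by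
  obtain ⟨-, U, hU, -⟩ := hΦ.eigenfunction
  exact hU.1

theorem IsGroundState.spectral_gap_le (hΦ : IsGroundState Ω Φ) (hd : 1 ≤ d)
    (hΩ : IsOpen Ω) (hΩc : IsConnected Ω) (hΩb : Bornology.IsBounded Ω) (hU : MemW012 Ω Φ U)
    (heq : ∀ v V, MemW012 Ω v V → ∫ x in Ω, inner ℝ (U x) (V x) =
      dirichletEigenvalue Ω 1 * ∫ x in Ω, Φ x * v x) (hf : MemW012 Ω f F) :
    (dirichletEigenvalue Ω 2 - dirichletEigenvalue Ω 1) *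
      ∫ x in Ω, (f x - (∫ y in Ω, f y * Φ y) * Φ x) ^ 2 ≤
        ∫ x in Ω, ‖F x - (f x / Φ x) • U x‖ ^ 2 := by
  set a := ∫ y in Ω, f y * Φ y with ha
  have hf' := hf.add (hU.smul (-a))
  have horth : ∫ x in Ω, (f + (-a) • Φ) x * Φ x = 0 := by
    have e : ∀ x, (f + (-a) • Φ) x * Φ x = f x * Φ x - a * Φ x ^ 2 := fun x => by
      simp only [Pi.add_apply, Pi.smul_apply, smul_eq_mul]
      ring
    have i : Integrable (fun x => f x * Φ x) (volume.restrict Ω) := hf.1.integrable_mul hΦ.memLp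
    simp_rw [e]
    rw [integral_sub i (hU.1.integrable_sq.const_mul a),
      integral_const_mul, hΦ.norm_eq_one, ← ha]
    ring
  have h1 := (hΦ.exists_second_eigenfunction hd hΩ hΩc hΩb).2.1 _ _ hf' horth
  have h2 := (hf'.sub_div_smul (hΦ.continuousOn.mono subset_closure) hΦ.pos hΩ.measurableSet hU
    hΦ.dirichletEigenvalue_one_nonneg heq).2
  -- Subtracting $a\Phi$ from $f$ changes $g$ by a constant and leaves $\Phi\nabla g$ unchanged.
  have e1 : ∫ x in Ω, ‖(F + (-a) • U) x - ((f + (-a) • Φ) x / Φ x) • U x‖ ^ 2 =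
      ∫ x in Ω, ‖F x - (f x / Φ x) • U x‖ ^ 2 := by
    refine setIntegral_congr_fun hΩ.measurableSet fun x hx => ?_
    have hx0 := (hΦ.pos x hx).ne'
    have : (f + (-a) • Φ) x / Φ x = f x / Φ x - a := by
      simp only [Pi.add_apply, Pi.smul_apply, smul_eq_mul]
      field_simp
      ring
    simp only [this]
    simp only [Pi.add_apply, Pi.smul_apply]
    congr 2
    module
  have e2 : ∀ x, (f + (-a) • Φ) x ^ 2 = (f x - a * Φ x) ^ 2 := fun x => by
    simp only [Pi.add_apply, Pi.smul_apply, smul_eq_mul]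
    ring
  simp_rw [e2] at h1 h2
  rw [e1] at h2
  rw [sub_mul, h2]
  linarith

/-- With $c$ the mean, the difference of the two sides is $(c-a)^2\int w$. -/
theorem integral_sq_sub_weightedMean_le (hw : IntegrableOn w Ω)
    (hpos : 0 < ∫ x in Ω, w x) (hgw : IntegrableOn (fun x => g x * w x) Ω)
    (hsq : ∀ c : ℝ, IntegrableOn (fun x => |g x - c| ^ 2 * w x) Ω) (a : ℝ) :
    ∫ x in Ω, |g x - weightedMean Ω w g| ^ 2 * w x ≤ ∫ x in Ω, |g x - a| ^ 2 * w x := by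
  set c := weightedMean Ω w g with hc
  have hcw : ∫ x in Ω, g x * w x = c * ∫ x in Ω, w x := by
    rw [hc, weightedMean, div_mul_cancel₀ _ hpos.ne']
  have e : ∀ x, |g x - a| ^ 2 * w x =
      |g x - c| ^ 2 * w x + ((2 * (c - a)) * (g x * w x) + (a ^ 2 - c ^ 2) * w x) := fun x => by
    rw [sq_abs, sq_abs]
    ring
  have i : Integrable (fun x => (2 * (c - a)) * (g x * w x) + (a ^ 2 - c ^ 2) * w x)
      (volume.restrict Ω) := (hgw.const_mul _).add (hw.const_mul _)
  simp_rw [e]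
  rw [integral_add (hsq c) i,
    integral_add (hgw.const_mul _) (hw.const_mul _), integral_const_mul, integral_const_mul, hcw]
  nlinarith [mul_nonneg (sq_nonneg (c - a)) hpos.le]

/-- The weighted Poincaré inequality for weights comparable with the square of the ground state. -/
theorem IsGroundState.weightedPoincare_of_le (hΦ : IsGroundState Ω Φ) (hd : 1 ≤ d)
    (hΩ : IsOpen Ω) (hΩc : IsConnected Ω) (hΩb : Bornology.IsBounded Ω) {A b B C : ℝ}
    (hwm : AEStronglyMeasurable w (volume.restrict Ω))
    (hWm : AEStronglyMeasurable W (volume.restrict Ω)) (hwpos : ∀ x ∈ Ω, 0 < w x)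
    (hwA : ∀ᵐ x ∂volume.restrict Ω, w x ≤ A * Φ x ^ 2) (hbW : ∀ x ∈ Ω, b * Φ x ^ 2 ≤ W x)
    (hWB : ∀ x ∈ Ω, W x ≤ B * Φ x ^ 2) (hC : 0 ≤ C) (hb : 0 ≤ b)
    (hCA : C * A ≤ (dirichletEigenvalue Ω 2 - dirichletEigenvalue Ω 1) * b)
    (hf : MemW012 Ω f F) : WeightedPoincare Ω C w W (fun x => f x / Φ x) := by
  obtain ⟨-, U, hU, heq⟩ := hΦ.eigenfunction
  have hcont : ContinuousOn Φ Ω := hΦ.continuousOn.mono subset_closure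
  obtain ⟨hR, -⟩ := hf.sub_div_smul hcont hΦ.pos hΩ.measurableSet hU
    hΦ.dirichletEigenvalue_one_nonneg heq
  have hgap := hΦ.spectral_gap_le hd hΩ hΩc hΩb hU heq hf
  have hmem := ae_restrict_mem (μ := volume) hΩ.measurableSet
  have hgm : AEStronglyMeasurable (fun x => f x / Φ x) (volume.restrict Ω) :=
    (hf.1.1.aemeasurable.div hU.1.1.aemeasurable).aestronglyMeasurable
  have i1 : IntegrableOn w Ω := by
    refine (hU.1.integrable_sq.const_mul A).mono' hwm ?_
    filter_upwards [hwA, hmem] with x hx hxΩ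
    rwa [Real.norm_of_nonneg (hwpos x hxΩ).le]
  have p1 : 0 < ∫ x in Ω, w x := by
    rw [setIntegral_pos_iff_support_of_nonneg_ae _ i1]
    · have hs : Ω ⊆ Function.support w := fun x hx => (hwpos x hx).ne'
      rw [inter_eq_self_of_subset_right hs]
      exact hΩ.measure_pos volume hΩc.nonempty
    · filter_upwards [hmem] with x hx using (hwpos x hx).le
  have i2 : IntegrableOn (fun x => f x / Φ x * w x) Ω := by
    refine ((hf.1.norm.integrable_mul hU.1).const_mul A).mono' (hgm.mul hwm) ?_
    filter_upwards [hwA, hmem] with x hx hxΩ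
    have hx0 := hΦ.pos x hxΩ
    rw [norm_mul, norm_div, Real.norm_of_nonneg (hwpos x hxΩ).le, Real.norm_of_nonneg hx0.le]
    calc ‖f x‖ / Φ x * w x ≤ ‖f x‖ / Φ x * (A * Φ x ^ 2) := by gcongr
      _ = A * (‖f x‖ * Φ x) := by field_simp
  have key : ∀ c : ℝ, ∀ᵐ x ∂volume.restrict Ω,
      |f x / Φ x - c| ^ 2 * w x ≤ A * (f x - c * Φ x) ^ 2 := by
    intro c
    filter_upwards [hwA, hmem] with x hx hxΩ
    have hx0 := hΦ.pos x hxΩ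
    calc |f x / Φ x - c| ^ 2 * w x ≤ |f x / Φ x - c| ^ 2 * (A * Φ x ^ 2) := by gcongr
      _ = A * (f x - c * Φ x) ^ 2 := by
        rw [sq_abs]
        field_simp
  have j3 : ∀ c : ℝ, Integrable (fun x => A * (f x - c * Φ x) ^ 2) (volume.restrict Ω) :=
    fun c => (hf.1.sub (hU.1.const_mul c)).integrable_sq.const_mul A
  have i3 : ∀ c : ℝ, IntegrableOn (fun x => |f x / Φ x - c| ^ 2 * w x) Ω := by
    intro c
    refine (j3 c).mono' (((hgm.sub aestronglyMeasurable_const).norm.pow 2).mul hwm) ?_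
    filter_upwards [key c, hmem] with x hx hxΩ
    rwa [Real.norm_of_nonneg (mul_nonneg (sq_nonneg _) (hwpos x hxΩ).le)]
  have eG : ∀ x ∈ Ω, ‖(Φ x)⁻¹ • (F x - (f x / Φ x) • U x)‖ ^ 2 =
      ‖F x - (f x / Φ x) • U x‖ ^ 2 / Φ x ^ 2 := by
    intro x hx
    rw [norm_smul, norm_inv, Real.norm_of_nonneg (hΦ.pos x hx).le]
    ring
  have hlow : ∀ x ∈ Ω, b * ‖F x - (f x / Φ x) • U x‖ ^ 2 ≤
      ‖(Φ x)⁻¹ • (F x - (f x / Φ x) • U x)‖ ^ 2 * W x := by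
    intro x hx
    have hx0 := hΦ.pos x hx
    rw [eG x hx]
    calc _ = ‖F x - (f x / Φ x) • U x‖ ^ 2 / Φ x ^ 2 * (b * Φ x ^ 2) := by field_simp
      _ ≤ _ := by
        gcongr
        exact hbW x hx
  have hW0 : ∀ x ∈ Ω, 0 ≤ W x := fun x hx => (mul_nonneg hb (sq_nonneg _)).trans (hbW x hx)
  have i4 : IntegrableOn (fun x => ‖(Φ x)⁻¹ • (F x - (f x / Φ x) • U x)‖ ^ 2 * W x) Ω := by
    refine ((integrable_norm_sq hR).const_mul B).mono'
      (((hU.1.1.aemeasurable.inv.aestronglyMeasurable.smul hR.1).norm.pow 2).mul hWm) ?_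
    filter_upwards [hmem] with x hx
    have hx0 := hΦ.pos x hx
    rw [Real.norm_of_nonneg (mul_nonneg (sq_nonneg _) (hW0 x hx)), eG x hx]
    calc _ ≤ ‖F x - (f x / Φ x) • U x‖ ^ 2 / Φ x ^ 2 * (B * Φ x ^ 2) := by
          gcongr
          exact hWB x hx
      _ = _ := by field_simp
  refine ⟨_, hf.hasWeakGradient_div hcont hΦ.pos hΩ hU hR, i1, p1, i2, i3 _, i4, ?_⟩
  -- This is the mean of $g$ for the weight $\Phi^2$; the mean for $w$ may be replaced by it because
  -- the latter is optimal for $w$.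
  set a := ∫ y in Ω, f y * Φ y
  have hQ : 0 ≤ ∫ x in Ω, (f x - a * Φ x) ^ 2 := integral_nonneg fun x => sq_nonneg _
  calc C * ∫ x in Ω, |f x / Φ x - weightedMean Ω w fun x => f x / Φ x| ^ 2 * w x
      ≤ C * ∫ x in Ω, |f x / Φ x - a| ^ 2 * w x :=
        mul_le_mul_of_nonneg_left (integral_sq_sub_weightedMean_le i1 p1 i2 i3 a) hC
    _ ≤ C * ∫ x in Ω, A * (f x - a * Φ x) ^ 2 :=
        mul_le_mul_of_nonneg_left (integral_mono_ae (i3 a) (j3 a) (key a)) hC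
    _ = C * A * ∫ x in Ω, (f x - a * Φ x) ^ 2 := by rw [integral_const_mul, mul_assoc]
    _ ≤ (dirichletEigenvalue Ω 2 - dirichletEigenvalue Ω 1) * b *
        ∫ x in Ω, (f x - a * Φ x) ^ 2 := mul_le_mul_of_nonneg_right hCA hQ
    _ = b * ((dirichletEigenvalue Ω 2 - dirichletEigenvalue Ω 1) *
        ∫ x in Ω, (f x - a * Φ x) ^ 2) := by ring
    _ ≤ b * ∫ x in Ω, ‖F x - (f x / Φ x) • U x‖ ^ 2 := mul_le_mul_of_nonneg_left hgap hb
    _ = ∫ x in Ω, b * ‖F x - (f x / Φ x) • U x‖ ^ 2 := (integral_const_mul _ _).symm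
    _ ≤ _ := setIntegral_mono_on ((integrable_norm_sq hR).const_mul b) i4 hΩ.measurableSet hlow

/-- The spectral gap is the optimal constant for the weight `Φ²`. -/
theorem IsGroundState.isGreatest_spectral_gap (hΦ : IsGroundState Ω Φ) (hd : 1 ≤ d)
    (hΩ : IsOpen Ω) (hΩc : IsConnected Ω) (hΩb : Bornology.IsBounded Ω) :
    IsGreatest {C : ℝ | ∀ f F, MemW012 Ω f F →
      WeightedPoincare Ω C (fun x => Φ x ^ 2) (fun x => Φ x ^ 2) (fun x => f x / Φ x)}
      (dirichletEigenvalue Ω 2 - dirichletEigenvalue Ω 1) := by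
  obtain ⟨hlt, -, f, F, hf, hfΦ, hf1, hF⟩ := hΦ.exists_second_eigenfunction hd hΩ hΩc hΩb
  have hm : AEStronglyMeasurable (fun x => Φ x ^ 2) (volume.restrict Ω) := hΦ.memLp.1.pow 2
  refine ⟨fun f F hf => hΦ.weightedPoincare_of_le hd hΩ hΩc hΩb (A := 1) (b := 1) (B := 1) hm hm
    (fun x hx => pow_pos (hΦ.pos x hx) 2) (by simp) (by simp) (by simp) (sub_pos.2 hlt).le
    zero_le_one le_rfl hf, fun C hC => ?_⟩
  obtain ⟨-, U, hU, heq⟩ := hΦ.eigenfunction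
  have hcont : ContinuousOn Φ Ω := hΦ.continuousOn.mono subset_closure
  obtain ⟨hR, hR2⟩ := hf.sub_div_smul hcont hΦ.pos hΩ.measurableSet hU
    hΦ.dirichletEigenvalue_one_nonneg heq
  obtain ⟨G, hG, -, -, -, -, -, hle⟩ := hC f F hf
  -- The inequality supplies some weak gradient; uniqueness identifies it with the explicit one,
  -- whose energy is known.
  have hG' := hG.unique hΩ (hf.hasWeakGradient_div hcont hΦ.pos hΩ hU hR)
  have hmean : weightedMean Ω (fun x => Φ x ^ 2) (fun x => f x / Φ x) = 0 := by
    rw [weightedMean, hΦ.norm_eq_one, div_one, ← hfΦ]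
    refine setIntegral_congr_fun hΩ.measurableSet fun x hx => ?_
    have hx0 := (hΦ.pos x hx).ne'
    field_simp
  have e1 : ∫ x in Ω, |f x / Φ x - 0| ^ 2 * Φ x ^ 2 = 1 := by
    rw [← hf1]
    refine setIntegral_congr_fun hΩ.measurableSet fun x hx => ?_
    have hx0 := (hΦ.pos x hx).ne'
    simp only [sub_zero, sq_abs]
    field_simp
  have e2 : ∫ x in Ω, ‖G x‖ ^ 2 * Φ x ^ 2 =
      dirichletEigenvalue Ω 2 - dirichletEigenvalue Ω 1 := by
    rw [← hF, ← mul_one (dirichletEigenvalue Ω 1), ← hf1, ← hR2]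
    refine integral_congr_ae ?_
    filter_upwards [hG', ae_restrict_mem hΩ.measurableSet] with x hx hxΩ
    have hx0 := hΦ.pos x hxΩ
    rw [hx, norm_smul, norm_inv, Real.norm_of_nonneg hx0.le]
    field_simp
  rw [hmean, e1, e2, mul_one] at hle
  exact hle

theorem sobolevExponent_nonneg : 0 ≤ sobolevExponent d := by
  unfold sobolevExponent
  positivity

/-- The weighted Poincaré inequality for a weight `S` with `k₀ Φ ≤ S ^ m ≤ k₁ Φ`. -/
theorem IsComparableWeight.weightedPoincare (hΦ : IsGroundState Ω Φ) (hd : 1 ≤ d)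
    (hΩ : IsOpen Ω) (hΩc : IsConnected Ω) (hΩb : Bornology.IsBounded Ω) {m k₀ k₁ : ℝ}
    (hm0 : 0 < m) (hm1 : m ≤ 1) (hk₀ : 0 < k₀) {S : EuclideanSpace ℝ (Fin d) → ℝ}
    (hS : IsComparableWeight Ω Φ m k₀ k₁ S) (hf : MemW012 Ω f F) :
    WeightedPoincare Ω ((dirichletEigenvalue Ω 2 - dirichletEigenvalue Ω 1) * k₀ ^ 2 /
      (k₁ ^ 2 * supNorm Ω S ^ (1 - m)))
      (fun x => S x ^ (1 + m)) (fun x => S x ^ (2 * m)) (fun x => f x / Φ x) := by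
  have hlt := (hΦ.exists_second_eigenfunction hd hΩ hΩc hΩb).1
  have hsub : ∀ x ∈ Ω, x ∈ closure Ω := fun x hx => subset_closure hx
  have hSm : ∀ x ∈ Ω, 0 < S x ^ m := fun x hx =>
    (mul_pos hk₀ (hΦ.pos x hx)).trans_le (hS.lower x (hsub x hx))
  have hSpos : ∀ x ∈ Ω, 0 < S x := by
    intro x hx
    refine (hS.nonneg x (hsub x hx)).lt_of_ne fun h => ?_
    have := hSm x hx
    rw [← h, Real.zero_rpow hm0.ne'] at this
    exact this.false
  have hk₁ : 0 < k₁ := by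
    obtain ⟨x, hx⟩ := hΩc.nonempty
    have := (hSm x hx).trans_le (hS.upper x (hsub x hx))
    exact pos_of_mul_pos_left this (hΦ.pos x hx).le
  obtain ⟨D, hD⟩ := hΩb.isCompact_closure.exists_bound_of_continuousOn hΦ.continuousOn
  have hmem := ae_restrict_mem (μ := volume) hΩ.measurableSet
  have hbound : ∀ x ∈ Ω, ‖S x‖ ≤ (k₁ * D) ^ m⁻¹ := by
    intro x hx
    rw [Real.norm_of_nonneg (hSpos x hx).le, ← Real.rpow_le_rpow_iff (hSpos x hx).le _ hm0,
      ← Real.rpow_mul, inv_mul_cancel₀ hm0.ne', Real.rpow_one]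
    · exact (hS.upper x (hsub x hx)).trans (mul_le_mul_of_nonneg_left
        ((le_abs_self _).trans (hD x (hsub x hx))) hk₁.le)
    · exact mul_nonneg hk₁.le ((norm_nonneg _).trans (hD x (hsub x hx)))
    · exact Real.rpow_nonneg (mul_nonneg hk₁.le ((norm_nonneg _).trans (hD x (hsub x hx)))) _
  -- Finiteness ensures that `supNorm` is a genuine a.e. bound and not the default value of `toReal`
  -- at `⊤`.
  have htop : eLpNorm S ⊤ (volume.restrict Ω) < ⊤ :=
    (memLp_top_of_bound hS.aestronglyMeasurable _ (by
      filter_upwards [hmem] with x hx using hbound x hx)).2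
  have hle : ∀ᵐ x ∂volume.restrict Ω, S x ≤ supNorm Ω S := by
    filter_upwards [ae_le_eLpNormEssSup (f := S) (μ := volume.restrict Ω)] with x hx
    rw [← eLpNorm_exponent_top] at hx
    have := ENNReal.toReal_mono htop.ne hx
    rw [toReal_enorm] at this
    exact (le_abs_self _).trans this
  have hN : 0 < supNorm Ω S := by
    have hne : volume.restrict Ω ≠ 0 := by
      rw [Ne, Measure.restrict_eq_zero]
      exact (hΩ.measure_pos volume hΩc.nonempty).ne'
    have hnb := ae_neBot.2 hne
    obtain ⟨x, hx, hxΩ⟩ := (hle.and hmem).exists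
    exact (hSpos x hxΩ).trans_le hx
  have e2 : ∀ x ∈ Ω, S x ^ (2 * m) = (S x ^ m) ^ 2 := fun x hx => by
    rw [mul_comm, Real.rpow_mul (hSpos x hx).le, Real.rpow_two]
  -- This splitting is where the factor $\|S\|_\infty^{1-m}$ comes from.
  have e1 : ∀ x ∈ Ω, S x ^ (1 + m) = S x ^ (1 - m) * (S x ^ m) ^ 2 := fun x hx => by
    rw [← e2 x hx, ← Real.rpow_add (hSpos x hx)]
    congr 1
    ring
  have hmeas : ∀ p : ℝ, AEStronglyMeasurable (fun x => S x ^ p) (volume.restrict Ω) := fun p =>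
    (hS.aestronglyMeasurable.aemeasurable.pow_const p).aestronglyMeasurable
  have hNp : 0 < supNorm Ω S ^ (1 - m) := Real.rpow_pos_of_pos hN _
  have hup : ∀ x ∈ Ω, (S x ^ m) ^ 2 ≤ k₁ ^ 2 * Φ x ^ 2 := fun x hx => by
    rw [← mul_pow]
    exact pow_le_pow_left₀ (hSm x hx).le (hS.upper x (hsub x hx)) 2
  refine hΦ.weightedPoincare_of_le hd hΩ hΩc hΩb (A := supNorm Ω S ^ (1 - m) * k₁ ^ 2)
    (b := k₀ ^ 2) (B := k₁ ^ 2) (hmeas _) (hmeas _)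
    (fun x hx => Real.rpow_pos_of_pos (hSpos x hx) _) ?_ (fun x hx => ?_) (fun x hx => ?_) ?_
    (sq_nonneg _) ?_ hf
  · filter_upwards [hle, hmem] with x hx hxΩ
    rw [e1 x hxΩ, mul_assoc]
    exact mul_le_mul (Real.rpow_le_rpow (hSpos x hxΩ).le hx (by linarith)) (hup x hxΩ)
      (sq_nonneg _) hNp.le
  · rw [e2 x hx, ← mul_pow]
    exact pow_le_pow_left₀ (mul_nonneg hk₀.le (hΦ.pos x hx).le) (hS.lower x (hsub x hx)) 2
  · rw [e2 x hx]
    exact hup x hx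
  · have := (sub_pos.2 hlt).le
    positivity
  · refine le_of_eq ?_
    field_simp

/-- The weighted mean is invariant under scaling of the weight, so the two sides scale by $\alpha$
and $\beta$. -/
theorem WeightedPoincare.of_eq_const_mul {C C' α β : ℝ} {w' W' : EuclideanSpace ℝ (Fin d) → ℝ}
    (h : WeightedPoincare Ω C w W g) (hΩ : MeasurableSet Ω) (hα : 0 < α)
    (hw : ∀ x ∈ Ω, w' x = α * w x) (hW : ∀ x ∈ Ω, W' x = β * W x) (hβ : 0 ≤ β)
    (hC : C' * α = C * β) : WeightedPoincare Ω C' w' W' g := by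
  obtain ⟨G, hG, i1, p1, i2, i3, i4, hle⟩ := h
  have e1 : ∫ x in Ω, w' x = α * ∫ x in Ω, w x := by
    rw [← integral_const_mul]
    exact setIntegral_congr_fun hΩ hw
  have h2 : EqOn (fun x => g x * w' x) (fun x => α * (g x * w x)) Ω := fun x hx => by
    simp only [hw x hx]
    ring
  have h3 : ∀ c, EqOn (fun x => |g x - c| ^ 2 * w' x) (fun x => α * (|g x - c| ^ 2 * w x)) Ω :=
    fun c x hx => by
      simp only [hw x hx]
      ring
  have h4 : EqOn (fun x => ‖G x‖ ^ 2 * W' x) (fun x => β * (‖G x‖ ^ 2 * W x)) Ω := fun x hx => by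
    simp only [hW x hx]
    ring
  have hmean : weightedMean Ω w' g = weightedMean Ω w g := by
    rw [weightedMean, weightedMean, e1, setIntegral_congr_fun hΩ h2, integral_const_mul,
      mul_div_mul_left _ _ hα.ne']
  refine ⟨G, hG, IntegrableOn.congr_fun (i1.const_mul α) (fun x hx => (hw x hx).symm) hΩ, ?_,
    IntegrableOn.congr_fun (i2.const_mul α) h2.symm hΩ, ?_, IntegrableOn.congr_fun (i4.const_mul β) h4.symm hΩ, ?_⟩
  · rw [e1]
    positivity
  · rw [hmean]
    exact IntegrableOn.congr_fun (i3.const_mul α) (h3 _).symm hΩ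
  · rw [hmean, setIntegral_congr_fun hΩ (h3 _), setIntegral_congr_fun hΩ h4, integral_const_mul,
      integral_const_mul, ← mul_assoc, hC, mul_comm C, mul_assoc]
    exact mul_le_mul_of_nonneg_left hle hβ

/-- The weighted Poincaré inequality for a positive weight `S` whose normalization is comparable
with the ground state. -/
theorem IsComparableWeight.weightedPoincare_of_normalizedProfile (hΦ : IsGroundState Ω Φ)
    (hd : 1 ≤ d) (hΩ : IsOpen Ω) (hΩc : IsConnected Ω) (hΩb : Bornology.IsBounded Ω)
    {m k₀ k₁ : ℝ} (hm0 : 0 < m) (hm1 : m ≤ 1) (hk₀ : 0 < k₀)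
    {S : EuclideanSpace ℝ (Fin d) → ℝ} (hSpos : ∀ x ∈ Ω, 0 < S x)
    (hS : IsComparableWeight Ω Φ m k₀ k₁ (normalizedProfile Ω m S)) (hf : MemW012 Ω f F) :
    WeightedPoincare Ω ((dirichletEigenvalue Ω 2 - dirichletEigenvalue Ω 1) * k₀ ^ 2 /
      (k₁ ^ 2 * supNorm Ω S ^ (1 - m)))
      (fun x => S x ^ (1 + m)) (fun x => S x ^ (2 * m)) (fun x => f x / Φ x) := by
  have h := hS.weightedPoincare hΦ hd hΩ hΩc hΩb hm0 hm1 hk₀ hf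
  obtain ⟨N, hN⟩ : ∃ N, (∫ y in Ω, S y ^ (m + 1)) ^ (1 / (m + 1)) = N := ⟨_, rfl⟩
  have hprof : normalizedProfile Ω m S = fun x => S x / N := by
    ext x
    rw [normalizedProfile, hN]
  rw [hprof] at h hS
  have hN0 : 0 ≤ N := by
    rw [← hN]
    exact Real.rpow_nonneg (setIntegral_nonneg hΩ.measurableSet fun x hx =>
      Real.rpow_nonneg (hSpos x hx).le _) _
  -- If $N=0$, which by convention includes a divergent integral, then division by zero makes the
  -- profile vanish, against its lower bound by $k_0\Phi$.
  have hNpos : 0 < N := by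
    refine hN0.lt_of_ne fun h0 => ?_
    obtain ⟨x, hx⟩ := hΩc.nonempty
    have := (mul_pos hk₀ (hΦ.pos x hx)).trans_le (hS.lower x (subset_closure hx))
    rw [← h0, div_zero, Real.zero_rpow hm0.ne'] at this
    exact this.false
  have hsup : supNorm Ω S = N * supNorm Ω (fun x => S x / N) := by
    have e : S = N • fun x => S x / N := by
      ext x
      rw [Pi.smul_apply, smul_eq_mul, mul_div_cancel₀ _ hNpos.ne']
    unfold supNorm
    conv_lhs => rw [e, eLpNorm_const_smul]
    rw [ENNReal.toReal_mul, toReal_enorm, Real.norm_of_nonneg hN0]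
  have hmul : ∀ p : ℝ, ∀ x ∈ Ω, S x ^ p = N ^ p * (S x / N) ^ p := fun p x hx => by
    rw [← Real.mul_rpow hN0 (div_nonneg (hSpos x hx).le hN0), mul_div_cancel₀ _ hNpos.ne']
  refine h.of_eq_const_mul hΩ.measurableSet (Real.rpow_pos_of_pos hNpos (1 + m)) (hmul _) (hmul _)
    (Real.rpow_nonneg hN0 _) ?_
  -- The weights scale by $N^{1+m}$ and $N^{2m}$; the missing $N^{1-m}$ is the scaling of
  -- $\|S\|_\infty^{1-m}$ in the constant.
  have hp : N ^ (1 + m) = N ^ (1 - m) * N ^ (2 * m) := by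
    rw [← Real.rpow_add hNpos]
    congr 1
    ring
  have hNm : N ^ (1 - m) ≠ 0 := (Real.rpow_pos_of_pos hNpos _).ne'
  have hs0 : 0 ≤ supNorm Ω fun x => S x / N := ENNReal.toReal_nonneg
  rw [hsup, Real.mul_rpow hN0 hs0, hp, div_mul_eq_mul_div, div_mul_eq_mul_div,
    show k₁ ^ 2 * (N ^ (1 - m) * supNorm Ω (fun x => S x / N) ^ (1 - m)) =
      N ^ (1 - m) * (k₁ ^ 2 * supNorm Ω (fun x => S x / N) ^ (1 - m)) by ring,
    mul_left_comm, mul_div_mul_left _ _ hNm]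

end WeightedInequalities

end FastDiffusion

end

theorem theorem5p1 {d : ℕ} (hd : 1 ≤ d) (Ω : Set (EuclideanSpace ℝ (Fin d)))
    (hΩo : IsOpen Ω) (hΩc : IsConnected Ω) (hΩb : Bornology.IsBounded Ω)
    (Φ : EuclideanSpace ℝ (Fin d) → ℝ) (hΦ : FastDiffusion.IsGroundState Ω Φ)
    (k₀ k₁ : ℝ → ℝ) (hk₀pos : ∀ m ∈ Ioc (FastDiffusion.sobolevExponent d) 1, 0 < k₀ m)
    (hk₀ : Tendsto k₀ (𝓝[<] 1) (𝓝 1)) (hk₁ : Tendsto k₁ (𝓝[<] 1) (𝓝 1))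
    (Λ : ℝ) (hΛ : Λ = FastDiffusion.dirichletEigenvalue Ω 2 -
      FastDiffusion.dirichletEigenvalue Ω 1) :
    -- the spectral gap is positive and is the optimal constant for the weight `Φ₁²`
    0 < Λ ∧
    IsGreatest {C : ℝ | ∀ f F, FastDiffusion.MemW012 Ω f F →
      FastDiffusion.WeightedPoincare Ω C (fun x => Φ x ^ 2) (fun x => Φ x ^ 2)
        (fun x => f x / Φ x)} Λ ∧
    -- weights comparable with the ground state
    (∀ m ∈ Ioc (FastDiffusion.sobolevExponent d) 1, ∀ S : EuclideanSpace ℝ (Fin d) → ℝ,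
      FastDiffusion.IsComparableWeight Ω Φ m (k₀ m) (k₁ m) S →
      ∀ f F, FastDiffusion.MemW012 Ω f F →
        FastDiffusion.WeightedPoincare Ω
          (Λ * k₀ m ^ 2 / (k₁ m ^ 2 * FastDiffusion.supNorm Ω S ^ (1 - m)))
          (fun x => S x ^ (1 + m)) (fun x => S x ^ (2 * m)) (fun x => f x / Φ x)) ∧
    -- rescaled stationary profiles
    (∀ m ∈ Ioo (FastDiffusion.sobolevExponent d) 1, ∀ c : ℝ, 0 < c →
      ∀ S : EuclideanSpace ℝ (Fin d) → ℝ, FastDiffusion.IsStationaryProfile Ω m c S →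
      FastDiffusion.IsComparableWeight Ω Φ m (k₀ m) (k₁ m)
        (FastDiffusion.normalizedProfile Ω m S) →
      ∀ f F, FastDiffusion.MemW012 Ω f F →
        FastDiffusion.WeightedPoincare Ω
          (Λ * k₀ m ^ 2 / (k₁ m ^ 2 * FastDiffusion.supNorm Ω S ^ (1 - m)))
          (fun x => S x ^ (1 + m)) (fun x => S x ^ (2 * m)) (fun x => f x / Φ x)) ∧
    Tendsto (fun m => k₁ m / k₀ m) (𝓝[<] 1) (𝓝 1) := by
  have h0 := FastDiffusion.sobolevExponent_nonneg (d := d)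
  subst hΛ
  refine ⟨sub_pos.2 (hΦ.exists_second_eigenfunction hd hΩo hΩc hΩb).1,
    hΦ.isGreatest_spectral_gap hd hΩo hΩc hΩb, ?_, ?_, ?_⟩
  · intro m hm S hS f F hf
    exact hS.weightedPoincare hΦ hd hΩo hΩc hΩb (h0.trans_lt hm.1) hm.2 (hk₀pos m hm) hf
  · intro m hm c _ S hSc hS f F hf
    exact hS.weightedPoincare_of_normalizedProfile hΦ hd hΩo hΩc hΩb (h0.trans_lt hm.1) hm.2.le
      (hk₀pos m ⟨hm.1, hm.2.le⟩) hSc.pos hf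
  · have h := hk₁.div hk₀ one_ne_zero
    rwa [div_one] at h
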